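/- Let $a>b>0$ and $c>0$, and let $H\subset\mathbb R^3$ be the non-rotational $2$-sheeted hyperboloid $$1+\Big(\frac{x_1}{a}\Big)^2+\Big(\frac{x_2}{b}\Big)^2=\Big(\frac{x_3}{c}\Big)^2$$ in Euclidean space. Put $$p=\sqrt{\frac{a^2-b^2}{a^2+c^2}},\qquad q=\sqrt{\frac{b^2+c^2}{a^2+c^2}},$$ so that $p,q\in(0,1)$ and $p^2+q^2=1$, and let $\mathrm{sn}_p,\mathrm{cn}_p:\mathbb C\to\mathbb C\cup\{\infty\}$ be the Jacobi elliptic functions with module $p$. Then the Christoffel dual of $H$ (away from the umbilics of $H$) admits the curvature line parametrization $$z=u+iv\ \mapsto\ x^\ast(z)=\mathrm{Re}\begin{pmatrix}\frac{2a}{p}\arctan\frac{1}{ip\,\mathrm{sn}_p}\\[2pt] \frac{2b}{pq}\,\mathrm{artanh}\frac{q}{ip\,\mathrm{cn}_p}\\[2pt] \frac{2c}{q}\,\mathrm{artanh}\Big(\frac{q}{i}\,\frac{\mathrm{sn}_p}{\mathrm{cn}_p}\Big)\end{pmatrix}(z).$$ Precisely: let $\Omega=\{u+iv\in\mathbb C:\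 \mathrm{sn}_q v\neq0,\ (\mathrm{cn}_p u,\mathrm{cn}_q v)\neq(0,0)\}$. There is a curvature line parametrization $x:\Omega\to\mathbb R^3$ whose image is $H$ without its umbilics, such that for every open $U\subseteq\Omega$ the following holds. If $U$ is simply connected, then the (multivalued) expression above has a continuous branch $x^\ast$ on $U$. Every continuous branch $x^\ast$ of it on $U$ is a curvature line parametrization, and $(x,x^\ast)$ is a Christoffel pair on $U$. (At the isolated poles of $\mathrm{sn}_p$ and $\mathrm{cn}_p$, $x^\ast$ is defined by continuity.) Here a curvature line parametrization is a smooth regular parametrized surface $f(u,v)$ whose parameters are orthogonal and conjugate, i.e. $\langle f_u,f_v\rangle=0$ and $\det(f_{uv},f_u,f_v)=0$; and two smooth regular parametrized surfaces $f,g$ form a Christoffel pair (each is a Christoffel dual of the other) if at corresponding points they have parallel tangent planes and the correspondence is conformal and reverses the orientation of the common tangent plane. -/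

import Mathlib

noncomputable section

/-- Euclidean three-space. -/
abbrev E3 : Type := EuclideanSpace ℝ (Fin 3)

/-! ### Jacobi elliptic functions with module `k ∈ [0, 1)` -/

/-- The incomplete elliptic integral of the first kind with module `k`. -/
def ellipticF (k φ : ℝ) : ℝ :=
  ∫ t in (0 : ℝ)..φ, 1 / Real.sqrt (1 - k ^ 2 * Real.sin t ^ 2)

/-- The Jacobi amplitude on the real line: the inverse of the bijection
`φ ↦ ellipticF k φ` (for `k ∈ [0, 1)`). -/
def jacobiAm (k u : ℝ) : ℝ := Function.invFun (ellipticF k) u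

/-- The real functions `sn`, `cn`, `dn` with module `k`. -/
def jacobiSn (k u : ℝ) : ℝ := Real.sin (jacobiAm k u)

def jacobiCn (k u : ℝ) : ℝ := Real.cos (jacobiAm k u)

def jacobiDn (k u : ℝ) : ℝ := Real.sqrt (1 - k ^ 2 * jacobiSn k u ^ 2)

/-- The complementary module. -/
def compModule (k : ℝ) : ℝ := Real.sqrt (1 - k ^ 2)

/-- Denominator in the formulas for `sn (u + i v)` and `cn (u + i v)`;
its zeros are the (common) poles of `sn` and `cn`. -/
def jacobiDenom (k : ℝ) (z : ℂ) : ℝ :=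
  jacobiCn (compModule k) z.im ^ 2
    + k ^ 2 * jacobiSn k z.re ^ 2 * jacobiSn (compModule k) z.im ^ 2

/-- `z` is a pole of the complex functions `sn` and `cn` with module `k`. -/
def IsJacobiPole (k : ℝ) (z : ℂ) : Prop := jacobiDenom k z = 0

/-- The meromorphic function `sn` with module `k`, in terms of the real functions with module `k`
and with complementary module (addition theorem and Jacobi's imaginary transformation);
only its values away from the poles are meaningful. -/
def jacobiSnC (k : ℝ) (z : ℂ) : ℂ :=
  ((jacobiSn k z.re * jacobiDn (compModule k) z.im : ℝ)
    + Complex.I * (jacobiCn k z.re * jacobiDn k z.re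
        * jacobiSn (compModule k) z.im * jacobiCn (compModule k) z.im : ℝ))
    / (jacobiDenom k z : ℝ)

/-- The meromorphic function `cn` with module `k`;
only its values away from the poles are meaningful. -/
def jacobiCnC (k : ℝ) (z : ℂ) : ℂ :=
  ((jacobiCn k z.re * jacobiCn (compModule k) z.im : ℝ)
    - Complex.I * (jacobiSn k z.re * jacobiDn k z.re
        * jacobiSn (compModule k) z.im * jacobiDn (compModule k) z.im : ℝ))
    / (jacobiDenom k z : ℝ)

/-! ### Values of the multivalued inverse functions -/

/-- `θ` is one of the values of `arctan w`. -/
def IsArctanValue (w θ : ℂ) : Prop := Complex.cos θ ≠ 0 ∧ Complex.tan θ = w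

/-- `θ` is one of the values of `artanh w`. -/
def IsArtanhValue (w θ : ℂ) : Prop := Complex.cosh θ ≠ 0 ∧ Complex.tanh θ = w

/-! ### Parametrized surfaces; the parameters are `z = u + i v` -/

/-- The partial derivative `f_u`. -/
def partialU (f : ℂ → E3) (z : ℂ) : E3 := fderiv ℝ f z 1

/-- The partial derivative `f_v`. -/
def partialV (f : ℂ → E3) (z : ℂ) : E3 := fderiv ℝ f z Complex.I

/-- The determinant of three vectors. -/
def det3 (x y z : E3) : ℝ := Matrix.det (Matrix.of ![⇑x, ⇑y, ⇑z])

/-- `f` is a smooth regular parametrized surface on `U`. -/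
def IsRegularSurface (U : Set ℂ) (f : ℂ → E3) : Prop :=
  ContDiffOn ℝ (⊤ : ℕ∞) f U ∧ ∀ z ∈ U, LinearIndependent ℝ ![partialU f z, partialV f z]

/-- `f` is a curvature line parametrization on `U`: `(u, v)` are orthogonal conjugate
parameters of a regular surface. -/
def IsCurvatureLineParam (U : Set ℂ) (f : ℂ → E3) : Prop :=
  IsRegularSurface U f ∧
    ∀ z ∈ U, inner ℝ (partialU f z) (partialV f z) = 0 ∧
      det3 (partialV (partialU f) z) (partialU f z) (partialV f z) = 0

/-- `(f, g)` is a Christoffel pair on `U`: at corresponding points the two surfaces have parallel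
tangent planes, the correspondence is conformal, and it reverses the orientation of the
common tangent plane. -/
def IsChristoffelPair (U : Set ℂ) (f g : ℂ → E3) : Prop :=
  IsRegularSurface U f ∧ IsRegularSurface U g ∧
    ∀ z ∈ U,
      (∃ A : ℂ →ₗ[ℝ] ℂ, LinearMap.det A < 0 ∧ ∀ ξ : ℂ, fderiv ℝ g z ξ = fderiv ℝ f z (A ξ)) ∧
      (∃ m : ℝ, 0 < m ∧ ∀ ξ η : ℂ,
        inner ℝ (fderiv ℝ g z ξ) (fderiv ℝ g z η)
          = m * inner ℝ (fderiv ℝ f z ξ) (fderiv ℝ f z η))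

/-! ### The two-sheeted hyperboloid and its dual -/

/-- The two-sheeted hyperboloid `1 + (x₁/a)² + (x₂/b)² = (x₃/c)²`. -/
def hyperboloid (a b c : ℝ) : Set E3 :=
  {P | 1 + (P 0 / a) ^ 2 + (P 1 / b) ^ 2 = (P 2 / c) ^ 2}

/-- The umbilics of the hyperboloid: its points where the Hessian of the defining quadratic
polynomial (hence the second fundamental form), restricted to the tangent plane, is a multiple of
the induced metric. -/
def hyperboloidUmbilics (a b c : ℝ) : Set E3 :=
  {P | P ∈ hyperboloid a b c ∧ ∃ κ : ℝ, ∀ ξ : E3,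
    P 0 * ξ 0 / a ^ 2 + P 1 * ξ 1 / b ^ 2 - P 2 * ξ 2 / c ^ 2 = 0 →
      ξ 0 ^ 2 / a ^ 2 + ξ 1 ^ 2 / b ^ 2 - ξ 2 ^ 2 / c ^ 2
        = κ * (ξ 0 ^ 2 + ξ 1 ^ 2 + ξ 2 ^ 2)}

/-- The parameter domain: all `u + i v` with `sn_q v ≠ 0` (the lines `sn_q v = 0` correspond to
infinity and separate the two sheets), without the zeros `cn_p u = cn_q v = 0` of `dn_p`
(which correspond to the umbilics). -/
def dualDomain (p q : ℝ) : Set ℂ :=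
  {z | jacobiSn q z.im ≠ 0 ∧ ¬ (jacobiCn p z.re = 0 ∧ jacobiCn q z.im = 0)}

/-- `X` is, on `U`, a continuous branch of the (in its first component multivalued) map
`z ↦ Re (2a/p · arctan (1/(i p sn_p)), 2b/(pq) · artanh (q/(i p cn_p)),
2c/q · artanh ((q/i) · sn_p/cn_p))`. At the isolated poles of `sn_p` and `cn_p` the value is the
one prescribed by continuity. -/
def IsDualBranch (a b c p q : ℝ) (U : Set ℂ) (X : ℂ → E3) : Prop :=
  ContinuousOn X U ∧ ∀ z ∈ U, ¬ IsJacobiPole p z →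
    ∃ θ₁ θ₂ θ₃ : ℂ,
      IsArctanValue (1 / (Complex.I * p * jacobiSnC p z)) θ₁ ∧
      IsArtanhValue (q / (Complex.I * p * jacobiCnC p z)) θ₂ ∧
      IsArtanhValue (q / Complex.I * (jacobiSnC p z / jacobiCnC p z)) θ₃ ∧
      X z = !₂[2 * a / p * θ₁.re, 2 * b / (p * q) * θ₂.re, 2 * c / q * θ₃.re]

end

/-! ### Real Jacobi elliptic functions -/

/-! Write s, cn, d for sn, cn, dn of u with module p, and S, C, D for sn, cn, dn of v with module q.
Each coordinate of `hyperboloidParam` is a function of u times a function of v, so its partials are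
explicit: x_u = T / (S d²) and x_v = -T' / (d S²), with T = `tangentU` and T' = `tangentV`
polynomial in the Jacobi values. Orthogonality, conjugacy and regularity become polynomial
identities.

The real parts of the values of arctan and artanh are found without choosing branches. If θ is a
value of arctan w, then (cos 2 Re θ, sin 2 Re θ) is a positive multiple of (1 - |w|², 2 Re w), and
similarly for artanh with hyperbolic functions. For the arguments at hand this says that the first
component of x*, up to scale, is an angle t with d C cos t + p cn S sin t = 0, while the others are,
up to scale, artanh (p q s S / (d D)) and artanh (q S / d) (`exists_arctan_re_iff`,
`exists_artanh_re_iff₁`, `exists_artanh_re_iff₂`). Only the angle is multivalued.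

Differentiating these three functions produces one common denominator N = D² - p² s², positive away
from cn = C = 0, and x*_u = (2S/N) T, x*_v = (2d/N) T' (`IsDualBranch.regular`). Hence x*_u = ρ x_u
and x*_v = -ρ x_v with ρ = 2 S² d² / N > 0, which is Christoffel duality
(`isChristoffelPair_of_partials`).

The image is found by solving for s² and S² at a given point (`exists_squares_of_sum_lt_one`) and by
comparing the Hessian with the metric on T and T'. A branch on a simply connected set comes from a
continuous logarithm of d C + i p cn S. -/

theorem one_sub_sq_mul_sin_sq_pos {k : ℝ} (hk : k ^ 2 < 1) (t : ℝ) :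
    0 < 1 - k ^ 2 * Real.sin t ^ 2 := by
  nlinarith [Real.sin_sq_le_one t, sq_nonneg k, sq_nonneg (Real.sin t)]

theorem hasDerivAt_ellipticF {k : ℝ} (hk : k ^ 2 < 1) (φ : ℝ) :
    HasDerivAt (ellipticF k) (1 / Real.sqrt (1 - k ^ 2 * Real.sin φ ^ 2)) φ := by
  have hc : Continuous fun t : ℝ => 1 / Real.sqrt (1 - k ^ 2 * Real.sin t ^ 2) :=
    continuous_const.div (by fun_prop)
      fun t => (Real.sqrt_pos.2 (one_sub_sq_mul_sin_sq_pos hk t)).ne'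
  exact intervalIntegral.integral_hasDerivAt_right (hc.intervalIntegrable _ _)
    (hc.stronglyMeasurableAtFilter _ _) hc.continuousAt

theorem ellipticF_strictMono {k : ℝ} (hk : k ^ 2 < 1) : StrictMono (ellipticF k) :=
  strictMono_of_deriv_pos fun φ => by
    rw [(hasDerivAt_ellipticF hk φ).deriv]
    exact one_div_pos.2 (Real.sqrt_pos.2 (one_sub_sq_mul_sin_sq_pos hk φ))

/-- The integrand is at least 1, so `ellipticF k φ - φ` is monotone and `ellipticF k` is unbounded
in both directions. With strict monotonicity this makes `jacobiAm` a genuine inverse. -/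
theorem ellipticF_surjective {k : ℝ} (hk : k ^ 2 < 1) : Function.Surjective (ellipticF k) := by
  have hmono : Monotone fun φ => ellipticF k φ - φ := by
    refine monotone_of_deriv_nonneg
      (fun φ => ((hasDerivAt_ellipticF hk φ).sub (hasDerivAt_id φ)).differentiableAt) fun φ => ?_
    have h := ((hasDerivAt_ellipticF hk φ).sub (hasDerivAt_id φ)).deriv
    have h1 : Real.sqrt (1 - k ^ 2 * Real.sin φ ^ 2) ≤ 1 :=
      Real.sqrt_le_one.2 (by nlinarith [mul_nonneg (sq_nonneg k) (sq_nonneg (Real.sin φ))])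
    have h2 := (one_le_div (Real.sqrt_pos.2 (one_sub_sq_mul_sin_sq_pos hk φ))).2 h1
    change 0 ≤ deriv (ellipticF k - id) φ
    rw [h]
    linarith
  have hcont : Continuous (ellipticF k) :=
    continuous_iff_continuousAt.2 fun φ => (hasDerivAt_ellipticF hk φ).continuousAt
  have h0 : ellipticF k 0 = 0 := intervalIntegral.integral_same
  refine hcont.surjective ?_ ?_
  · refine Filter.tendsto_atTop_mono' _ ?_ Filter.tendsto_id
    filter_upwards [Filter.eventually_ge_atTop 0] with φ hφ
    have := hmono hφ
    simp only [h0] at this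
    simp only [id]
    linarith
  · refine Filter.tendsto_atBot_mono' _ ?_ Filter.tendsto_id
    filter_upwards [Filter.eventually_le_atBot 0] with φ hφ
    have := hmono hφ
    simp only [h0] at this
    simp only [id]
    linarith

theorem jacobiAm_ellipticF {k : ℝ} (hk : k ^ 2 < 1) (φ : ℝ) : jacobiAm k (ellipticF k φ) = φ :=
  Function.leftInverse_invFun (ellipticF_strictMono hk).injective φ

theorem ellipticF_jacobiAm {k : ℝ} (hk : k ^ 2 < 1) (u : ℝ) : ellipticF k (jacobiAm k u) = u :=
  Function.rightInverse_invFun (ellipticF_surjective hk) u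

theorem jacobiAm_surjective {k : ℝ} (hk : k ^ 2 < 1) : Function.Surjective (jacobiAm k) :=
  fun φ => ⟨_, jacobiAm_ellipticF hk φ⟩

theorem continuous_jacobiAm {k : ℝ} (hk : k ^ 2 < 1) : Continuous (jacobiAm k) := by
  have hmono : StrictMono (jacobiAm k) := fun u v huv => by
    rw [← (ellipticF_strictMono hk).lt_iff_lt, ellipticF_jacobiAm hk, ellipticF_jacobiAm hk]
    exact huv
  exact hmono.monotone.continuous_of_surjective (jacobiAm_surjective hk)

theorem hasDerivAt_jacobiAm {k : ℝ} (hk : k ^ 2 < 1) (u : ℝ) :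
    HasDerivAt (jacobiAm k) (jacobiDn k u) u := by
  have hpos := Real.sqrt_pos.2 (one_sub_sq_mul_sin_sq_pos hk (jacobiAm k u))
  have h := HasDerivAt.of_local_left_inverse (continuous_jacobiAm hk).continuousAt
    (hasDerivAt_ellipticF hk (jacobiAm k u)) (one_div_pos.2 hpos).ne'
    (Filter.Eventually.of_forall fun v => ellipticF_jacobiAm hk v)
  simpa [jacobiDn, jacobiSn] using h

/-- Bootstrapping: am' = √(1 - k² sin² am) is a smooth function of am, so each order of smoothness
of am yields the next. -/
theorem contDiff_jacobiAm {k : ℝ} (hk : k ^ 2 < 1) : ContDiff ℝ (⊤ : ℕ∞) (jacobiAm k) := by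
  have hd : deriv (jacobiAm k) = jacobiDn k := funext fun u => (hasDerivAt_jacobiAm hk u).deriv
  refine contDiff_infty.2 fun n => ?_
  induction n with
  | zero => exact contDiff_zero.2 (continuous_jacobiAm hk)
  | succ n ih =>
    push_cast
    refine contDiff_succ_iff_deriv.2
      ⟨fun u => (hasDerivAt_jacobiAm hk u).differentiableAt, by simp, ?_⟩
    rw [hd]
    exact ((contDiff_const.sub (contDiff_const.mul ((Real.contDiff_sin.comp ih).pow 2))).sqrt
      fun u => (one_sub_sq_mul_sin_sq_pos hk (jacobiAm k u)).ne')

theorem contDiff_jacobiSn {k : ℝ} (hk : k ^ 2 < 1) : ContDiff ℝ (⊤ : ℕ∞) (jacobiSn k) :=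
  Real.contDiff_sin.comp (contDiff_jacobiAm hk)

theorem contDiff_jacobiCn {k : ℝ} (hk : k ^ 2 < 1) : ContDiff ℝ (⊤ : ℕ∞) (jacobiCn k) :=
  Real.contDiff_cos.comp (contDiff_jacobiAm hk)

theorem jacobiDn_pos {k : ℝ} (hk : k ^ 2 < 1) (u : ℝ) : 0 < jacobiDn k u :=
  Real.sqrt_pos.2 (one_sub_sq_mul_sin_sq_pos hk (jacobiAm k u))

theorem contDiff_jacobiDn {k : ℝ} (hk : k ^ 2 < 1) : ContDiff ℝ (⊤ : ℕ∞) (jacobiDn k) :=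
  (contDiff_const.sub (contDiff_const.mul ((contDiff_jacobiSn hk).pow 2))).sqrt
    fun u => (one_sub_sq_mul_sin_sq_pos hk (jacobiAm k u)).ne'

theorem jacobiCn_sq (k u : ℝ) : jacobiCn k u ^ 2 = 1 - jacobiSn k u ^ 2 :=
  Real.cos_sq' _

theorem jacobiDn_sq {k : ℝ} (hk : k ^ 2 < 1) (u : ℝ) :
    jacobiDn k u ^ 2 = 1 - k ^ 2 * jacobiSn k u ^ 2 :=
  Real.sq_sqrt (one_sub_sq_mul_sin_sq_pos hk (jacobiAm k u)).le

theorem hasDerivAt_jacobiSn {k : ℝ} (hk : k ^ 2 < 1) (u : ℝ) :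
    HasDerivAt (jacobiSn k) (jacobiCn k u * jacobiDn k u) u :=
  (Real.hasDerivAt_sin _).comp u (hasDerivAt_jacobiAm hk u)

theorem hasDerivAt_jacobiCn {k : ℝ} (hk : k ^ 2 < 1) (u : ℝ) :
    HasDerivAt (jacobiCn k) (-jacobiSn k u * jacobiDn k u) u :=
  (Real.hasDerivAt_cos _).comp u (hasDerivAt_jacobiAm hk u)

theorem hasDerivAt_jacobiDn {k : ℝ} (hk : k ^ 2 < 1) (u : ℝ) :
    HasDerivAt (jacobiDn k) (-k ^ 2 * jacobiSn k u * jacobiCn k u) u := by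
  have h := ((((hasDerivAt_jacobiSn hk u).pow 2).const_mul (k ^ 2)).const_sub 1).sqrt
    (one_sub_sq_mul_sin_sq_pos hk (jacobiAm k u)).ne'
  refine h.congr_deriv ?_
  have hd := (jacobiDn_pos hk u).ne'
  change _ / (2 * jacobiDn k u) = _
  field_simp
  ring

theorem exists_jacobi_eq {k : ℝ} (hk : k ^ 2 < 1) {s c : ℝ} (h : c ^ 2 + s ^ 2 = 1) :
    ∃ u, jacobiSn k u = s ∧ jacobiCn k u = c := by
  obtain ⟨u, hu⟩ := jacobiAm_surjective hk (Complex.arg ⟨c, s⟩)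
  have hn : ‖(⟨c, s⟩ : ℂ)‖ = 1 := by
    rw [Complex.norm_def, Complex.normSq_mk, ← pow_two, ← pow_two, h, Real.sqrt_one]
  refine ⟨u, ?_, ?_⟩
  · simp [jacobiSn, hu, Complex.sin_arg, hn]
  · rw [jacobiCn, hu, Complex.cos_arg (by rintro h0; simp [h0] at hn), hn]
    simp

/-! ### Parametrized surfaces -/

theorem fderiv_eq_partials (f : ℂ → E3) (z ξ : ℂ) :
    fderiv ℝ f z ξ = ξ.re • partialU f z + ξ.im • partialV f z := by
  have h : ξ = ξ.re • (1 : ℂ) + ξ.im • Complex.I := by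
    apply Complex.ext <;> simp
  conv_lhs => rw [h, map_add, map_smul, map_smul]
  rfl

theorem det3_smul_add {x y z : E3} (h : det3 x y z = 0) (r s t m : ℝ) :
    det3 (r • x + s • y) (t • y) (m • z) = 0 := by
  have h' : det3 (r • x + s • y) (t • y) (m • z) = r * t * m * det3 x y z := by
    simp only [det3, Matrix.det_fin_three, Matrix.of_apply, Matrix.cons_val_zero,
      Matrix.cons_val_one, Matrix.cons_val, PiLp.add_apply, PiLp.smul_apply, smul_eq_mul]
    ring
  rw [h', h, mul_zero]

/-- If the partial derivatives of `g` are `ρ f_u` and `-ρ f_v` for a curvature line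
parametrization `f` and a positive function `ρ`, then `g` is a Christoffel dual of `f`. -/
theorem IsCurvatureLineParam.isChristoffelPair_of_partials {U : Set ℂ} (hU : IsOpen U)
    {f g : ℂ → E3} (hf : IsCurvatureLineParam U f) (hg : ContDiffOn ℝ (⊤ : ℕ∞) g U) {ρ : ℂ → ℝ}
    (hρ : ∀ z ∈ U, 0 < ρ z) (hρd : ∀ z ∈ U, DifferentiableAt ℝ ρ z)
    (hu : ∀ z ∈ U, partialU g z = ρ z • partialU f z)
    (hv : ∀ z ∈ U, partialV g z = -ρ z • partialV f z) :
    IsCurvatureLineParam U g ∧ IsChristoffelPair U f g := by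
  have hreg : IsRegularSurface U g := by
    refine ⟨hg, fun z hz => ?_⟩
    have hi := LinearIndependent.pair_iff.1 (hf.1.2 z hz)
    refine LinearIndependent.pair_iff.2 fun s t hst => ?_
    rw [hu z hz, hv z hz, smul_smul, smul_smul] at hst
    simpa [(hρ z hz).ne'] using hi _ _ hst
  refine ⟨⟨hreg, fun z hz => ⟨?_, ?_⟩⟩, hf.1, hreg, fun z hz => ⟨?_, ?_⟩⟩
  · rw [hu z hz, hv z hz, inner_smul_left, inner_smul_right, (hf.2 z hz).1]
    simp
  · have hfd : DifferentiableAt ℝ (partialU f) z :=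
      (((hf.1.1.fderiv_of_isOpen hU (m := 1) (by norm_cast)).differentiableOn
        one_ne_zero).differentiableAt (hU.mem_nhds hz)).clm_apply (differentiableAt_const _)
    have he : partialU g =ᶠ[nhds z] fun w => ρ w • partialU f w :=
      Filter.eventually_of_mem (hU.mem_nhds hz) hu
    have h2 : partialV (partialU g) z
        = ρ z • partialV (partialU f) z + fderiv ℝ ρ z Complex.I • partialU f z := by
      rw [partialV, he.fderiv_eq, fderiv_fun_smul (hρd z hz) hfd]
      rfl
    rw [h2, hu z hz, hv z hz]
    exact det3_smul_add (hf.2 z hz).2 _ _ _ _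
  -- Conjugation fixes the u-direction and reverses the v-direction; scaled by ρ it has determinant
  -- -ρ².
  · refine ⟨ρ z • Complex.conjAe.toLinearMap, ?_, fun ξ => ?_⟩
    · rw [LinearMap.det_smul, Complex.det_conjAe]
      simpa using pow_pos (hρ z hz) 2
    · rw [fderiv_eq_partials, fderiv_eq_partials f, hu z hz, hv z hz]
      simp [smul_smul, mul_comm]
  · refine ⟨ρ z ^ 2, pow_pos (hρ z hz) 2, fun ξ η => ?_⟩
    have ho := (hf.2 z hz).1
    have ho' : inner ℝ (partialV f z) (partialU f z) = 0 := by rw [real_inner_comm, ho]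
    rw [fderiv_eq_partials, fderiv_eq_partials g, fderiv_eq_partials f, fderiv_eq_partials f,
      hu z hz, hv z hz]
    simp only [inner_add_left, inner_add_right, real_inner_smul_left, real_inner_smul_right, ho,
      ho']
    ring

/-! ### Functions of `u + i v` given by their partial derivatives -/

/-- `f` is differentiable at `z` with `f_u = α` and `f_v = β`. -/
def HasPartials (f : ℂ → ℝ) (α β : ℝ) (z : ℂ) : Prop :=
  HasFDerivAt f (α • Complex.reCLM + β • Complex.imCLM) z

theorem HasPartials.congr {f : ℂ → ℝ} {α β α' β' : ℝ} {z : ℂ} (h : HasPartials f α β z)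
    (hα : α = α') (hβ : β = β') : HasPartials f α' β' z := by
  subst hα hβ; exact h

theorem HasDerivAt.hasPartials_re {f : ℝ → ℝ} {f' : ℝ} {z : ℂ} (h : HasDerivAt f f' z.re) :
    HasPartials (fun w => f w.re) f' 0 z := by
  refine (h.comp_hasFDerivAt z Complex.reCLM.hasFDerivAt).congr_fderiv ?_
  simp

theorem HasDerivAt.hasPartials_im {f : ℝ → ℝ} {f' : ℝ} {z : ℂ} (h : HasDerivAt f f' z.im) :
    HasPartials (fun w => f w.im) 0 f' z := by
  refine (h.comp_hasFDerivAt z Complex.imCLM.hasFDerivAt).congr_fderiv ?_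
  simp

theorem HasPartials.mul {f g : ℂ → ℝ} {α β α' β' : ℝ} {z : ℂ} (hf : HasPartials f α β z)
    (hg : HasPartials g α' β' z) :
    HasPartials (fun w => f w * g w) (f z * α' + g z * α) (f z * β' + g z * β) z := by
  refine (HasFDerivAt.mul hf hg).congr_fderiv ?_
  ext w
  simp
  ring

theorem HasPartials.add {f g : ℂ → ℝ} {α β α' β' : ℝ} {z : ℂ} (hf : HasPartials f α β z)
    (hg : HasPartials g α' β' z) : HasPartials (fun w => f w + g w) (α + α') (β + β') z := by
  refine (HasFDerivAt.add hf hg).congr_fderiv ?_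
  ext w
  simp
  ring

theorem HasPartials.const_mul {f : ℂ → ℝ} {α β : ℝ} {z : ℂ} (hf : HasPartials f α β z) (r : ℝ) :
    HasPartials (fun w => r * f w) (r * α) (r * β) z := by
  refine (HasFDerivAt.const_mul hf r).congr_fderiv ?_
  ext w
  simp
  ring

theorem HasDerivAt.comp_hasPartials {g : ℝ → ℝ} {g' : ℝ} {f : ℂ → ℝ} {α β : ℝ} {z : ℂ}
    (hg : HasDerivAt g g' (f z)) (hf : HasPartials f α β z) :
    HasPartials (fun w => g (f w)) (g' * α) (g' * β) z := by
  refine (hg.comp_hasFDerivAt z hf).congr_fderiv ?_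
  ext w
  simp
  ring

/-- Partial derivatives of `r f(u) g(v)`. -/
theorem HasDerivAt.hasPartials_const_mul_mul {f g : ℝ → ℝ} {f' g' : ℝ} {z : ℂ}
    (hf : HasDerivAt f f' z.re) (hg : HasDerivAt g g' z.im) (r : ℝ) :
    HasPartials (fun w => r * (f w.re * g w.im)) (r * (f' * g z.im)) (r * (f z.re * g')) z :=
  ((hf.hasPartials_re.mul hg.hasPartials_im).const_mul r).congr (by ring) (by ring)

theorem hasFDerivAt_of_hasPartials {f : ℂ → E3} {z : ℂ} {α β : E3}
    (h : ∀ i, HasPartials (fun w => f w i) (α i) (β i) z) :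
    HasFDerivAt f (Complex.reCLM.smulRight α + Complex.imCLM.smulRight β) z := by
  refine hasFDerivWithinAt_univ.1 (hasFDerivWithinAt_euclidean.2 fun i => ?_)
  refine ((h i).congr_fderiv ?_).hasFDerivWithinAt
  ext w
  simp
  ring

theorem partialU_of_hasPartials {f : ℂ → E3} {z : ℂ} {α β : E3}
    (h : ∀ i, HasPartials (fun w => f w i) (α i) (β i) z) : partialU f z = α := by
  simp [partialU, (hasFDerivAt_of_hasPartials h).fderiv]

theorem partialV_of_hasPartials {f : ℂ → E3} {z : ℂ} {α β : E3}
    (h : ∀ i, HasPartials (fun w => f w i) (α i) (β i) z) : partialV f z = β := by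
  simp [partialV, (hasFDerivAt_of_hasPartials h).fderiv]

/-! ### The Jacobi functions of `u` (module `p`) and of `v` (module `q`) -/

/-- Values `s, c, d = sn, cn, dn` with module `p` and `S, C, D = sn, cn, dn` with the
complementary module `q`. -/
structure JacobiValues (p q s c d S C D : ℝ) : Prop where
  pq : p ^ 2 + q ^ 2 = 1
  p_pos : 0 < p
  q_pos : 0 < q
  c_sq : c ^ 2 = 1 - s ^ 2
  d_sq : d ^ 2 = 1 - p ^ 2 * s ^ 2
  d_pos : 0 < d
  C_sq : C ^ 2 = 1 - S ^ 2
  D_sq : D ^ 2 = 1 - q ^ 2 * S ^ 2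
  D_pos : 0 < D

namespace JacobiValues

variable {p q s c d S C D : ℝ}

theorem p_sq_lt (h : JacobiValues p q s c d S C D) : p ^ 2 < 1 := by
  nlinarith [h.pq, h.q_pos]

theorem q_sq_lt (h : JacobiValues p q s c d S C D) : q ^ 2 < 1 := by
  nlinarith [h.pq, h.p_pos]

/-- Four faces of the same quantity N, a multiple of |dn z|². The first is the squared length of the
vector defining the angle, the second shows where N vanishes, the third is up to sign and the factor
ab a minor of the two tangent vectors, and the fourth is the denominator from the last artanh. -/
theorem norm_eq₁ (h : JacobiValues p q s c d S C D) :
    D ^ 2 - p ^ 2 * s ^ 2 = d ^ 2 * C ^ 2 + p ^ 2 * c ^ 2 * S ^ 2 := by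
  rw [h.c_sq, h.C_sq, h.d_sq, h.D_sq]; linear_combination (-S ^ 2) * h.pq

theorem norm_eq₂ (h : JacobiValues p q s c d S C D) :
    D ^ 2 - p ^ 2 * s ^ 2 = p ^ 2 * c ^ 2 + q ^ 2 * C ^ 2 := by
  rw [h.c_sq, h.C_sq, h.D_sq]; linear_combination -h.pq

theorem norm_eq₃ (h : JacobiValues p q s c d S C D) :
    D ^ 2 - p ^ 2 * s ^ 2 = q ^ 2 * s ^ 2 * C ^ 2 + c ^ 2 * D ^ 2 := by
  rw [h.c_sq, h.C_sq, h.D_sq]; linear_combination (-s ^ 2) * h.pq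

theorem norm_eq₄ (h : JacobiValues p q s c d S C D) :
    D ^ 2 - p ^ 2 * s ^ 2 = d ^ 2 - q ^ 2 * S ^ 2 := by
  rw [h.D_sq, h.d_sq]; ring

theorem norm_pos (h : JacobiValues p q s c d S C D) (hcC : ¬ (c = 0 ∧ C = 0)) :
    0 < D ^ 2 - p ^ 2 * s ^ 2 := by
  rw [h.norm_eq₂]
  have hp := h.p_pos
  have hq := h.q_pos
  by_cases hc : c = 0
  · have hC : C ≠ 0 := fun hC => hcC ⟨hc, hC⟩
    positivity
  · positivity

end JacobiValues

theorem jacobiValues {p q : ℝ} (hp : 0 < p) (hq : 0 < q) (hpq : p ^ 2 + q ^ 2 = 1) (u v : ℝ) :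
    JacobiValues p q (jacobiSn p u) (jacobiCn p u) (jacobiDn p u)
      (jacobiSn q v) (jacobiCn q v) (jacobiDn q v) := by
  have hp2 : p ^ 2 < 1 := by nlinarith
  have hq2 : q ^ 2 < 1 := by nlinarith
  exact ⟨hpq, hp, hq, jacobiCn_sq p u, jacobiDn_sq hp2 u, jacobiDn_pos hp2 u,
    jacobiCn_sq q v, jacobiDn_sq hq2 v, jacobiDn_pos hq2 v⟩



/-! ### Derivatives of quotients of Jacobi functions of one real variable. -/

theorem hasDerivAt_jacobiCn_div_jacobiDn {k : ℝ} (hk : k ^ 2 < 1) (u : ℝ) :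
    HasDerivAt (fun t => jacobiCn k t / jacobiDn k t)
      (-(1 - k ^ 2) * jacobiSn k u / jacobiDn k u ^ 2) u := by
  have hd := (jacobiDn_pos hk u).ne'
  refine ((hasDerivAt_jacobiCn hk u).div (hasDerivAt_jacobiDn hk u) hd).congr_deriv ?_
  congr 1
  have h1 := jacobiDn_sq hk u
  have h2 := jacobiCn_sq k u
  linear_combination (-jacobiSn k u) * h1 + k ^ 2 * jacobiSn k u * h2

theorem hasDerivAt_jacobiSn_div_jacobiDn {k : ℝ} (hk : k ^ 2 < 1) (u : ℝ) :
    HasDerivAt (fun t => jacobiSn k t / jacobiDn k t) (jacobiCn k u / jacobiDn k u ^ 2) u := by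
  have hd := (jacobiDn_pos hk u).ne'
  refine ((hasDerivAt_jacobiSn hk u).div (hasDerivAt_jacobiDn hk u) hd).congr_deriv ?_
  congr 1
  have h1 := jacobiDn_sq hk u
  linear_combination jacobiCn k u * h1

theorem hasDerivAt_one_div_jacobiDn {k : ℝ} (hk : k ^ 2 < 1) (u : ℝ) :
    HasDerivAt (fun t => 1 / jacobiDn k t)
      (k ^ 2 * jacobiSn k u * jacobiCn k u / jacobiDn k u ^ 2) u := by
  have hd := (jacobiDn_pos hk u).ne'
  refine ((hasDerivAt_const u (1 : ℝ)).div (hasDerivAt_jacobiDn hk u) hd).congr_deriv ?_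
  congr 1
  ring

theorem hasDerivAt_jacobiCn_div_jacobiSn {k : ℝ} (hk : k ^ 2 < 1) {v : ℝ} (h : jacobiSn k v ≠ 0) :
    HasDerivAt (fun t => jacobiCn k t / jacobiSn k t) (-jacobiDn k v / jacobiSn k v ^ 2) v := by
  refine ((hasDerivAt_jacobiCn hk v).div (hasDerivAt_jacobiSn hk v) h).congr_deriv ?_
  congr 1
  have h2 := jacobiCn_sq k v
  linear_combination (-jacobiDn k v) * h2

theorem hasDerivAt_jacobiDn_div_jacobiSn {k : ℝ} (hk : k ^ 2 < 1) {v : ℝ} (h : jacobiSn k v ≠ 0) :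
    HasDerivAt (fun t => jacobiDn k t / jacobiSn k t) (-jacobiCn k v / jacobiSn k v ^ 2) v := by
  refine ((hasDerivAt_jacobiDn hk v).div (hasDerivAt_jacobiSn hk v) h).congr_deriv ?_
  congr 1
  have h2 := jacobiDn_sq hk v
  linear_combination (-jacobiCn k v) * h2

theorem hasDerivAt_one_div_jacobiSn {k : ℝ} (hk : k ^ 2 < 1) {v : ℝ} (h : jacobiSn k v ≠ 0) :
    HasDerivAt (fun t => 1 / jacobiSn k t)
      (-(jacobiCn k v * jacobiDn k v) / jacobiSn k v ^ 2) v := by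
  refine ((hasDerivAt_const v (1 : ℝ)).div (hasDerivAt_jacobiSn hk v) h).congr_deriv ?_
  congr 1
  ring

/-! ### The curvature line parametrization of the hyperboloid -/

/-- Relations between the semi-axes of the hyperboloid and the modules `p` and `q`. -/
structure HyperboloidModules (a b c p q : ℝ) : Prop where
  a_pos : 0 < a
  b_pos : 0 < b
  c_pos : 0 < c
  p_pos : 0 < p
  q_pos : 0 < q
  pq : p ^ 2 + q ^ 2 = 1
  p_sq : p ^ 2 * (a ^ 2 + c ^ 2) = a ^ 2 - b ^ 2

theorem hyperboloidModules {a b c p q : ℝ} (hb : 0 < b) (hc : 0 < c) (hab : b < a)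
    (hp : p = Real.sqrt ((a ^ 2 - b ^ 2) / (a ^ 2 + c ^ 2)))
    (hq : q = Real.sqrt ((b ^ 2 + c ^ 2) / (a ^ 2 + c ^ 2))) : HyperboloidModules a b c p q := by
  have ha : 0 < a := hb.trans hab
  have hL : 0 < a ^ 2 + c ^ 2 := by positivity
  have h1 : 0 < (a ^ 2 - b ^ 2) / (a ^ 2 + c ^ 2) := div_pos (by nlinarith) hL
  have h2 : 0 < (b ^ 2 + c ^ 2) / (a ^ 2 + c ^ 2) := by positivity
  have hp2 : p ^ 2 = (a ^ 2 - b ^ 2) / (a ^ 2 + c ^ 2) := by rw [hp, Real.sq_sqrt h1.le]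
  have hq2 : q ^ 2 = (b ^ 2 + c ^ 2) / (a ^ 2 + c ^ 2) := by rw [hq, Real.sq_sqrt h2.le]
  refine ⟨ha, hb, hc, hp ▸ Real.sqrt_pos.2 h1, hq ▸ Real.sqrt_pos.2 h2, ?_, ?_⟩
  · rw [hp2, hq2]; field_simp; ring
  · rw [hp2]; field_simp

namespace HyperboloidModules

variable {a b c p q : ℝ}

theorem jacobiValues (h : HyperboloidModules a b c p q) (u v : ℝ) :
    JacobiValues p q (jacobiSn p u) (jacobiCn p u) (jacobiDn p u)
      (jacobiSn q v) (jacobiCn q v) (jacobiDn q v) :=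
  _root_.jacobiValues h.p_pos h.q_pos h.pq u v

theorem p_sq_lt (h : HyperboloidModules a b c p q) : p ^ 2 < 1 := (h.jacobiValues 0 0).p_sq_lt

theorem q_sq_lt (h : HyperboloidModules a b c p q) : q ^ 2 < 1 := (h.jacobiValues 0 0).q_sq_lt

end HyperboloidModules

/-- The curvature line parametrization `(a cd u cs v, b sd u ds v, c nd u ns v)` of the
hyperboloid. -/
noncomputable def hyperboloidParam (a b c p q : ℝ) (z : ℂ) : E3 :=
  !₂[a * (jacobiCn p z.re / jacobiDn p z.re * (jacobiCn q z.im / jacobiSn q z.im)),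
    b * (jacobiSn p z.re / jacobiDn p z.re * (jacobiDn q z.im / jacobiSn q z.im)),
    c * (1 / jacobiDn p z.re * (1 / jacobiSn q z.im))]

/-- A multiple of the tangent vectors `x_u` and `x*_u`. -/
noncomputable def tangentU (a b c p q : ℝ) (z : ℂ) : E3 :=
  !₂[a * (-q ^ 2 * jacobiSn p z.re * jacobiCn q z.im),
    b * (jacobiCn p z.re * jacobiDn q z.im),
    c * (p ^ 2 * jacobiSn p z.re * jacobiCn p z.re)]

/-- A multiple of the tangent vectors `x_v` and `x*_v`. -/
noncomputable def tangentV (a b c p q : ℝ) (z : ℂ) : E3 :=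
  !₂[a * (jacobiCn p z.re * jacobiDn q z.im),
    b * (jacobiSn p z.re * jacobiCn q z.im),
    c * (jacobiCn q z.im * jacobiDn q z.im)]

theorem isOpen_dualDomain {p q : ℝ} (hp : p ^ 2 < 1) (hq : q ^ 2 < 1) :
    IsOpen (dualDomain p q) := by
  have h1 : Continuous (jacobiSn q) := (contDiff_jacobiSn hq).continuous
  have h2 : Continuous (jacobiCn q) := (contDiff_jacobiCn hq).continuous
  have h3 : Continuous (jacobiCn p) := (contDiff_jacobiCn hp).continuous
  refine IsOpen.inter (isOpen_ne_fun (h1.comp Complex.continuous_im) continuous_const) ?_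
  exact (IsClosed.inter (isClosed_eq (h3.comp Complex.continuous_re) continuous_const)
    (isClosed_eq (h2.comp Complex.continuous_im) continuous_const)).isOpen_compl

variable {a b c p q : ℝ}

theorem partials_hyperboloidParam (h : HyperboloidModules a b c p q) {z : ℂ}
    (hz : z ∈ dualDomain p q) :
    partialU (hyperboloidParam a b c p q) z
      = (1 / (jacobiSn q z.im * jacobiDn p z.re ^ 2)) • tangentU a b c p q z ∧
    partialV (hyperboloidParam a b c p q) z
      = -(1 / (jacobiDn p z.re * jacobiSn q z.im ^ 2)) • tangentV a b c p q z := by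
  have hp := h.p_sq_lt
  have hq := h.q_sq_lt
  have hd := (jacobiDn_pos hp z.re).ne'
  have hS := hz.1
  have H : ∀ i, HasPartials (fun w => hyperboloidParam a b c p q w i)
      (((1 / (jacobiSn q z.im * jacobiDn p z.re ^ 2)) • tangentU a b c p q z) i)
      ((-(1 / (jacobiDn p z.re * jacobiSn q z.im ^ 2)) • tangentV a b c p q z) i) z := by
    have e : 1 - p ^ 2 = q ^ 2 := by linear_combination -h.pq
    intro i
    fin_cases i
    · refine ((hasDerivAt_jacobiCn_div_jacobiDn hp z.re).hasPartials_const_mul_mul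
        (hasDerivAt_jacobiCn_div_jacobiSn hq hS) a).congr ?_ ?_
      · simp [tangentU, e]; field_simp
      · simp [tangentV]; field_simp
    · refine ((hasDerivAt_jacobiSn_div_jacobiDn hp z.re).hasPartials_const_mul_mul
        (hasDerivAt_jacobiDn_div_jacobiSn hq hS) b).congr ?_ ?_
      · simp [tangentU]; field_simp
      · simp [tangentV]; field_simp
    · refine ((hasDerivAt_one_div_jacobiDn hp z.re).hasPartials_const_mul_mul
        (hasDerivAt_one_div_jacobiSn hq hS) c).congr ?_ ?_
      · simp [tangentU]; field_simp
      · simp [tangentV]; field_simp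
  exact ⟨partialU_of_hasPartials H, partialV_of_hasPartials H⟩

theorem partialV_partialU_hyperboloidParam (h : HyperboloidModules a b c p q) {z : ℂ}
    (hz : z ∈ dualDomain p q) :
    partialV (partialU (hyperboloidParam a b c p q)) z
      = (1 / (jacobiSn q z.im ^ 2 * jacobiDn p z.re ^ 2)) •
        !₂[a * (q ^ 2 * jacobiSn p z.re * jacobiDn q z.im),
          -b * (jacobiCn p z.re * jacobiCn q z.im),
          -c * (p ^ 2 * jacobiSn p z.re * jacobiCn p z.re * jacobiCn q z.im * jacobiDn q z.im)] := by
  have hp := h.p_sq_lt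
  have hq := h.q_sq_lt
  have hd := (jacobiDn_pos hp z.re).ne'
  have hS := hz.1
  have he : partialU (hyperboloidParam a b c p q) =ᶠ[nhds z] fun w =>
      (1 / (jacobiSn q w.im * jacobiDn p w.re ^ 2)) • tangentU a b c p q w :=
    Filter.eventually_of_mem ((isOpen_dualDomain hp hq).mem_nhds hz)
      fun w hw => (partials_hyperboloidParam h hw).1
  rw [partialV, he.fderiv_eq]
  have hsd : DifferentiableAt ℝ (fun t => jacobiSn p t / jacobiDn p t ^ 2) z.re :=
    (hasDerivAt_jacobiSn hp _).differentiableAt.div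
      ((hasDerivAt_jacobiDn hp _).differentiableAt.pow 2) (by positivity)
  have hcd : DifferentiableAt ℝ (fun t => jacobiCn p t / jacobiDn p t ^ 2) z.re :=
    (hasDerivAt_jacobiCn hp _).differentiableAt.div
      ((hasDerivAt_jacobiDn hp _).differentiableAt.pow 2) (by positivity)
  have hscd : DifferentiableAt ℝ (fun t => jacobiSn p t * jacobiCn p t / jacobiDn p t ^ 2) z.re :=
    ((hasDerivAt_jacobiSn hp _).differentiableAt.mul
      (hasDerivAt_jacobiCn hp _).differentiableAt).div
      ((hasDerivAt_jacobiDn hp _).differentiableAt.pow 2) (by positivity)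
  -- Only the v-partials are wanted; the u-partials merely have to exist, so they stay as
  -- unevaluated `deriv`s.
  refine partialV_of_hasPartials (α := !₂[
    a * (-q ^ 2) * (deriv (fun t => jacobiSn p t / jacobiDn p t ^ 2) z.re
      * (jacobiCn q z.im / jacobiSn q z.im)),
    b * (deriv (fun t => jacobiCn p t / jacobiDn p t ^ 2) z.re
      * (jacobiDn q z.im / jacobiSn q z.im)),
    c * p ^ 2 * (deriv (fun t => jacobiSn p t * jacobiCn p t / jacobiDn p t ^ 2) z.re
      * (1 / jacobiSn q z.im))]) fun i => ?_
  fin_cases i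
  · convert! (hsd.hasDerivAt.hasPartials_const_mul_mul
        (hasDerivAt_jacobiCn_div_jacobiSn hq hS) (a * (-q ^ 2))) using 1
    · funext w; simp [tangentU]; field_simp
    · simp; field_simp
  · convert! (hcd.hasDerivAt.hasPartials_const_mul_mul
        (hasDerivAt_jacobiDn_div_jacobiSn hq hS) b) using 1
    · funext w; simp [tangentU]; field_simp
    · simp; field_simp
  · convert! (hscd.hasDerivAt.hasPartials_const_mul_mul
        (hasDerivAt_one_div_jacobiSn hq hS) (c * p ^ 2)) using 1
    · funext w; simp [tangentU]; field_simp
    · simp; field_simp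

theorem inner_tangentU_tangentV (h : HyperboloidModules a b c p q) (z : ℂ) :
    inner ℝ (tangentU a b c p q z) (tangentV a b c p q z) = 0 := by
  simp [tangentU, tangentV, PiLp.inner_apply, Fin.sum_univ_three]
  linear_combination (jacobiSn p z.re * jacobiCn p z.re * jacobiCn q z.im * jacobiDn q z.im) *
    (h.p_sq - a ^ 2 * h.pq)

theorem linearIndependent_tangent (h : HyperboloidModules a b c p q) {z : ℂ}
    (hz : z ∈ dualDomain p q) :
    LinearIndependent ℝ ![tangentU a b c p q z, tangentV a b c p q z] := by
  have hN := (h.jacobiValues z.re z.im).norm_pos hz.2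
  rw [(h.jacobiValues z.re z.im).norm_eq₃] at hN
  refine LinearIndependent.pair_iff.2 fun r t hrt => ?_
  have h0 := congrArg (fun P : E3 => P 0) hrt
  have h1 := congrArg (fun P : E3 => P 1) hrt
  simp [tangentU, tangentV] at h0 h1
  have ha := h.a_pos.ne'
  have hb := h.b_pos.ne'
  -- In the first two coordinates the determinant of the system is, after removing a and b, minus
  -- the third form of N; Cramer's rule finishes.
  have h0' : r * (-q ^ 2 * jacobiSn p z.re * jacobiCn q z.im)
      + t * (jacobiCn p z.re * jacobiDn q z.im) = 0 := by
    apply mul_left_cancel₀ ha; linear_combination h0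
  have h1' : r * (jacobiCn p z.re * jacobiDn q z.im)
      + t * (jacobiSn p z.re * jacobiCn q z.im) = 0 := by
    apply mul_left_cancel₀ hb; linear_combination h1
  constructor
  · apply mul_right_cancel₀ hN.ne'
    linear_combination (jacobiCn p z.re * jacobiDn q z.im) * h1'
      - (jacobiSn p z.re * jacobiCn q z.im) * h0'
  · apply mul_right_cancel₀ hN.ne'
    linear_combination (jacobiCn p z.re * jacobiDn q z.im) * h0'
      + (q ^ 2 * jacobiSn p z.re * jacobiCn q z.im) * h1'

theorem det3_mixed_tangent (h : HyperboloidModules a b c p q) (z : ℂ) :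
    det3 (!₂[a * (q ^ 2 * jacobiSn p z.re * jacobiDn q z.im),
        -b * (jacobiCn p z.re * jacobiCn q z.im),
        -c * (p ^ 2 * jacobiSn p z.re * jacobiCn p z.re * jacobiCn q z.im * jacobiDn q z.im)])
      (tangentU a b c p q z) (tangentV a b c p q z) = 0 := by
  have hJ := h.jacobiValues z.re z.im
  have h2 := hJ.norm_eq₂
  have h3 := hJ.norm_eq₃
  simp only [det3, Matrix.det_fin_three, tangentU, tangentV, Matrix.of_apply,
    Matrix.cons_val_zero, Matrix.cons_val_one, Matrix.cons_val]
  linear_combination (a * b * c * jacobiSn p z.re * jacobiCn p z.re * jacobiCn q z.im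
    * jacobiDn q z.im) * (h2 - p ^ 2 * h3
      + (jacobiDn q z.im ^ 2 - p ^ 2 * jacobiSn p z.re ^ 2) * h.pq)

theorem contDiffOn_hyperboloidParam (h : HyperboloidModules a b c p q) :
    ContDiffOn ℝ (⊤ : ℕ∞) (hyperboloidParam a b c p q) (dualDomain p q) := by
  have hp := h.p_sq_lt
  have hq := h.q_sq_lt
  have re : ∀ {f : ℝ → ℝ}, ContDiff ℝ (⊤ : ℕ∞) f →
      ContDiffOn ℝ (⊤ : ℕ∞) (fun z : ℂ => f z.re) (dualDomain p q) :=
    fun hf => (hf.comp Complex.reCLM.contDiff).contDiffOn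
  have im : ∀ {f : ℝ → ℝ}, ContDiff ℝ (⊤ : ℕ∞) f →
      ContDiffOn ℝ (⊤ : ℕ∞) (fun z : ℂ => f z.im) (dualDomain p q) :=
    fun hf => (hf.comp Complex.imCLM.contDiff).contDiffOn
  have hd : ∀ z ∈ dualDomain p q, jacobiDn p z.re ≠ 0 := fun z _ => (jacobiDn_pos hp z.re).ne'
  have hS : ∀ z ∈ dualDomain p q, jacobiSn q z.im ≠ 0 := fun z hz => hz.1
  have hdc := re (contDiff_jacobiDn hp)
  have hSc := im (contDiff_jacobiSn hq)
  refine contDiffOn_euclidean.2 fun i => ?_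
  fin_cases i
  · exact contDiffOn_const.mul (((re (contDiff_jacobiCn hp)).div hdc hd).mul
      ((im (contDiff_jacobiCn hq)).div hSc hS))
  · exact contDiffOn_const.mul (((re (contDiff_jacobiSn hp)).div hdc hd).mul
      ((im (contDiff_jacobiDn hq)).div hSc hS))
  · exact contDiffOn_const.mul ((contDiffOn_const.div hdc hd).mul
      (contDiffOn_const.div hSc hS))

theorem isCurvatureLineParam_hyperboloidParam (h : HyperboloidModules a b c p q) :
    IsCurvatureLineParam (dualDomain p q) (hyperboloidParam a b c p q) := by
  refine ⟨⟨contDiffOn_hyperboloidParam h, fun z hz => ?_⟩, fun z hz => ⟨?_, ?_⟩⟩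
  · obtain ⟨hu, hv⟩ := partials_hyperboloidParam h hz
    have hi := LinearIndependent.pair_iff.1 (linearIndependent_tangent h hz)
    have hd := (jacobiDn_pos h.p_sq_lt z.re).ne'
    refine LinearIndependent.pair_iff.2 fun r t hrt => ?_
    rw [hu, hv, smul_smul, smul_smul] at hrt
    simpa [hd, hz.1] using hi _ _ hrt
  · obtain ⟨hu, hv⟩ := partials_hyperboloidParam h hz
    rw [hu, hv, inner_smul_left, inner_smul_right, inner_tangentU_tangentV h]
    simp
  · obtain ⟨hu, hv⟩ := partials_hyperboloidParam h hz
    rw [partialV_partialU_hyperboloidParam h hz, hu, hv]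
    -- A zero multiple of `tangentU` is inserted to match the shape of `det3_smul_add`.
    rw [← add_zero (_ • !₂[_, _, _]), ← zero_smul ℝ (tangentU a b c p q z)]
    exact det3_smul_add (det3_mixed_tangent h z) _ _ _ _

/-! ### The image of the parametrization -/

/-- This is the equation of the hyperboloid for `hyperboloidParam`, multiplied by d² S²;
geometrically, a unit sphere in sphero-conal coordinates. -/
theorem JacobiValues.sq_sum {p q s c d S C D : ℝ} (h : JacobiValues p q s c d S C D) :
    d ^ 2 * S ^ 2 + c ^ 2 * C ^ 2 + s ^ 2 * D ^ 2 = 1 := by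
  rw [h.c_sq, h.d_sq, h.C_sq, h.D_sq]
  linear_combination (-s ^ 2 * S ^ 2) * h.pq

theorem hyperboloidParam_mem (h : HyperboloidModules a b c p q) {z : ℂ}
    (hS : jacobiSn q z.im ≠ 0) : hyperboloidParam a b c p q z ∈ hyperboloid a b c := by
  have ha := h.a_pos.ne'
  have hb := h.b_pos.ne'
  have hc := h.c_pos.ne'
  have hd := (jacobiDn_pos h.p_sq_lt z.re).ne'
  have hJ := (h.jacobiValues z.re z.im).sq_sum
  simp only [hyperboloid, hyperboloidParam, Set.mem_ofPred_eq, Matrix.cons_val_zero,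
    Matrix.cons_val_one, Matrix.cons_val]
  rw [mul_div_cancel_left₀ _ ha, mul_div_cancel_left₀ _ hb, mul_div_cancel_left₀ _ hc]
  field_simp
  linear_combination hJ

/-- The combination d² q(T') - S² q(T) vanishes when q is the Hessian form and equals (a² + c²) N²
when q is the metric. A proportionality factor κ would therefore be 0, but the Hessian is S² N > 0
on T'. -/
theorem hyperboloidParam_notMem_umbilics (h : HyperboloidModules a b c p q) {z : ℂ}
    (hz : z ∈ dualDomain p q) :
    hyperboloidParam a b c p q z ∉ hyperboloidUmbilics a b c := by
  rintro ⟨-, κ, hκ⟩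
  have hS := hz.1
  have ha := h.a_pos.ne'
  have hb := h.b_pos.ne'
  have hc := h.c_pos.ne'
  have hd := (jacobiDn_pos h.p_sq_lt z.re).ne'
  have hJ := h.jacobiValues z.re z.im
  have hU := hκ (tangentU a b c p q z)
  have hV := hκ (tangentV a b c p q z)
  have hN := hJ.norm_pos hz.2
  simp only [hyperboloidParam, tangentU, tangentV, Matrix.cons_val_zero, Matrix.cons_val_one,
    Matrix.cons_val] at hU hV
  generalize jacobiSn p z.re = s at *
  generalize jacobiCn p z.re = x at *
  generalize jacobiDn p z.re = d at *
  generalize jacobiSn q z.im = S at *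
  generalize jacobiCn q z.im = C at *
  generalize jacobiDn q z.im = D at *
  have hU' := hU (by
    field_simp
    linear_combination s * x * (hJ.D_sq - q ^ 2 * hJ.C_sq - hJ.pq))
  have hV' := hV (by
    field_simp
    linear_combination C * D * hJ.c_sq)
  have eU : (a * (-q ^ 2 * s * C)) ^ 2 / a ^ 2 + (b * (x * D)) ^ 2 / b ^ 2
      - (c * (p ^ 2 * s * x)) ^ 2 / c ^ 2
      = q ^ 4 * s ^ 2 * C ^ 2 + x ^ 2 * D ^ 2 - p ^ 4 * s ^ 2 * x ^ 2 := by
    field_simp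
  have eV : (a * (x * D)) ^ 2 / a ^ 2 + (b * (s * C)) ^ 2 / b ^ 2 - (c * (C * D)) ^ 2 / c ^ 2
      = x ^ 2 * D ^ 2 + s ^ 2 * C ^ 2 - C ^ 2 * D ^ 2 := by
    field_simp
  rw [eU] at hU'
  rw [eV] at hV'
  have hb2 : b ^ 2 = a ^ 2 - p ^ 2 * (a ^ 2 + c ^ 2) := by linear_combination h.p_sq
  have hq2 : q ^ 2 = 1 - p ^ 2 := by linear_combination h.pq
  -- This says that (u, v) are conformal parameters for the second fundamental form.
  have hQ : d ^ 2 * (x ^ 2 * D ^ 2 + s ^ 2 * C ^ 2 - C ^ 2 * D ^ 2)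
      - S ^ 2 * (q ^ 4 * s ^ 2 * C ^ 2 + x ^ 2 * D ^ 2 - p ^ 4 * s ^ 2 * x ^ 2) = 0 := by
    rw [show q ^ 4 = (q ^ 2) ^ 2 by ring, hJ.c_sq, hJ.d_sq, hJ.C_sq, hJ.D_sq, hq2]
    ring
  have hG : d ^ 2 * ((a * (x * D)) ^ 2 + (b * (s * C)) ^ 2 + (c * (C * D)) ^ 2)
      - S ^ 2 * ((a * (-q ^ 2 * s * C)) ^ 2 + (b * (x * D)) ^ 2 + (c * (p ^ 2 * s * x)) ^ 2)
      = (a ^ 2 + c ^ 2) * (D ^ 2 - p ^ 2 * s ^ 2) ^ 2 := by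
    simp only [mul_pow]
    rw [hJ.c_sq, hJ.d_sq, hJ.C_sq, hJ.D_sq, hb2, neg_sq, hq2]
    ring
  have hκ0 : κ * ((a ^ 2 + c ^ 2) * (D ^ 2 - p ^ 2 * s ^ 2) ^ 2) = 0 := by
    linear_combination hQ - κ * hG - d ^ 2 * hV' + S ^ 2 * hU'
  have hL : 0 < a ^ 2 + c ^ 2 := by have := h.a_pos; positivity
  have hκ1 : κ = 0 := by
    rcases mul_eq_zero.1 hκ0 with h0 | h0
    · exact h0
    · exact absurd h0 (mul_pos hL (pow_pos hN 2)).ne'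
  have hQV : x ^ 2 * D ^ 2 + s ^ 2 * C ^ 2 - C ^ 2 * D ^ 2
      = S ^ 2 * (D ^ 2 - p ^ 2 * s ^ 2) := by
    rw [hJ.c_sq, hJ.C_sq, hJ.D_sq, hq2]
    ring
  rw [hκ1, zero_mul, hQV] at hV'
  exact (mul_pos (by positivity) hN).ne' hV'

theorem hyperboloidParam_mem_umbilics (h : HyperboloidModules a b c p q) {z : ℂ}
    (hS : jacobiSn q z.im ≠ 0) (hcp : jacobiCn p z.re = 0) (hcq : jacobiCn q z.im = 0) :
    hyperboloidParam a b c p q z ∈ hyperboloidUmbilics a b c := by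
  -- The first coordinate of the point is 0, so the tangent plane contains the first axis, on which
  -- the ratio of the two forms is 1/a².
  refine ⟨hyperboloidParam_mem h hS, 1 / a ^ 2, fun ξ hξ => ?_⟩
  have ha := h.a_pos.ne'
  have hb := h.b_pos.ne'
  have hc := h.c_pos.ne'
  have hd := (jacobiDn_pos h.p_sq_lt z.re).ne'
  have hJ := h.jacobiValues z.re z.im
  simp only [hyperboloidParam, Matrix.cons_val_zero, Matrix.cons_val_one, Matrix.cons_val, hcp,
    hcq] at hξ
  rw [hcp, hcq] at hJ
  have hs : jacobiSn p z.re ^ 2 = 1 := by linear_combination hJ.c_sq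
  have hD : jacobiDn q z.im ^ 2 = p ^ 2 := by
    linear_combination hJ.D_sq - q ^ 2 * hJ.C_sq - hJ.pq
  have h1 : c * (jacobiSn p z.re * jacobiDn q z.im * ξ 1) = b * ξ 2 := by
    simp only [zero_div, zero_mul, mul_zero, zero_add] at hξ
    field_simp at hξ
    linear_combination hξ
  have h2 : c ^ 2 * p ^ 2 * ξ 1 ^ 2 = b ^ 2 * ξ 2 ^ 2 := by
    rw [← hD, ← mul_pow b, ← h1]
    linear_combination (-c ^ 2 * jacobiDn q z.im ^ 2 * ξ 1 ^ 2) * hs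
  field_simp
  linear_combination (a ^ 2 + c ^ 2) * h2 - c ^ 2 * ξ 1 ^ 2 * h.p_sq

/-! ### Solving for the parameters of a given point. -/

/-- Here σ and τ stand for sn² u and sn² v. Eliminating σ leaves a quadratic in τ, positive at 0 and
negative at 1 when x ≠ 0. For x = 0 it factors, and the size of y² decides which root is admissible.
-/
theorem exists_squares_of_sum_lt_one {q x y : ℝ} (hq0 : 0 < q) (hq1 : q ^ 2 < 1)
    (h : x ^ 2 + y ^ 2 < 1) :
    ∃ σ τ : ℝ, 0 ≤ σ ∧ σ ≤ 1 ∧ 0 < τ ∧ τ ≤ 1 ∧ (1 - σ) * (1 - τ) = x ^ 2 ∧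
      σ * (1 - q ^ 2 * τ) = y ^ 2 := by
  have hq : 0 < q ^ 2 := by positivity
  by_cases hx : x = 0
  · subst hx
    by_cases hy : y ^ 2 ≤ 1 - q ^ 2
    · have hp : 0 < 1 - q ^ 2 := by linarith
      refine ⟨y ^ 2 / (1 - q ^ 2), 1, by positivity, (div_le_one hp).2 hy, one_pos, le_rfl,
        by ring, ?_⟩
      field_simp
    · push Not at hy
      refine ⟨1, (1 - y ^ 2) / q ^ 2, zero_le_one, le_rfl, div_pos (by nlinarith) hq,
        (div_le_one hq).2 (by linarith), by ring, ?_⟩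
      field_simp
      ring
  · have hx2 : 0 < x ^ 2 := by positivity
    let g : ℝ → ℝ := fun t =>
      (1 - t) * (1 - q ^ 2 * t) - x ^ 2 * (1 - q ^ 2 * t) - y ^ 2 * (1 - t)
    have hg : ContinuousOn g (Set.Icc 0 1) := by fun_prop
    have h0 : (0 : ℝ) ∈ Set.Icc (g 1) (g 0) := by
      constructor
      · have : 0 < x ^ 2 * (1 - q ^ 2) := mul_pos hx2 (by linarith)
        simp only [g]; linarith
      · simp only [g]; linarith
    obtain ⟨τ, hτ, hgτ⟩ := intermediate_value_Icc' zero_le_one hg h0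
    have hτ0 : τ ≠ 0 := by
      rintro rfl
      simp only [g] at hgτ; linarith
    have hτ1 : τ ≠ 1 := by
      rintro rfl
      have : 0 < x ^ 2 * (1 - q ^ 2) := mul_pos hx2 (by linarith)
      simp only [g] at hgτ; linarith
    have hτlt : τ < 1 := lt_of_le_of_ne hτ.2 hτ1
    have hD : 0 < 1 - q ^ 2 * τ := by nlinarith
    have e1 : (1 - y ^ 2 / (1 - q ^ 2 * τ)) * (1 - τ) = x ^ 2 := by
      field_simp
      simp only [g] at hgτ
      linear_combination hgτ
    refine ⟨y ^ 2 / (1 - q ^ 2 * τ), τ, by positivity, ?_, lt_of_le_of_ne hτ.1 hτ0.symm, hτ.2, e1,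
      ?_⟩
    · by_contra hlt
      push Not at hlt
      nlinarith
    · field_simp

theorem exists_jacobi_of_sum_lt_one (hp : 0 < p) (hq : 0 < q) (hpq : p ^ 2 + q ^ 2 = 1)
    {x y r : ℝ} (h : x ^ 2 + y ^ 2 < 1) (hr : r ≠ 0) :
    ∃ u v : ℝ, jacobiCn p u * jacobiCn q v = x ∧ jacobiSn p u * jacobiDn q v = y ∧
      0 < jacobiSn q v * r := by
  have hp2 : p ^ 2 < 1 := by nlinarith
  have hq2 : q ^ 2 < 1 := by nlinarith
  obtain ⟨σ, τ, hσ0, hσ1, hτ0, hτ1, hx, hy⟩ := exists_squares_of_sum_lt_one hq hq2 h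
  obtain ⟨S, hS, hSr⟩ : ∃ S : ℝ, S ^ 2 = τ ∧ 0 < S * r := by
    rcases lt_or_gt_of_ne hr with hr | hr
    · exact ⟨-Real.sqrt τ, by rw [neg_sq, Real.sq_sqrt hτ0.le],
        mul_pos_of_neg_of_neg (neg_neg_of_pos (Real.sqrt_pos.2 hτ0)) hr⟩
    · exact ⟨Real.sqrt τ, Real.sq_sqrt hτ0.le, mul_pos (Real.sqrt_pos.2 hτ0) hr⟩
  have hC : Real.sqrt (1 - τ) ^ 2 = 1 - τ := Real.sq_sqrt (by linarith)
  obtain ⟨v, hvS, hvC⟩ := exists_jacobi_eq hq2 (s := S) (c := Real.sqrt (1 - τ))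
    (by rw [hC, hS]; ring)
  have hD := jacobiDn_pos hq2 v
  have hD2 := jacobiDn_sq hq2 v
  rw [hvS, hS] at hD2
  have hs : (y / jacobiDn q v) ^ 2 = σ := by
    rw [div_pow, ← hy, ← hD2]
    field_simp
  -- The value cn u must carry the sign of x; if cn v = 0 then x = 0 and either sign works.
  obtain ⟨k, hk, hkx⟩ : ∃ k : ℝ, k ^ 2 = 1 - σ ∧ k * Real.sqrt (1 - τ) = x := by
    by_cases h0 : Real.sqrt (1 - τ) = 0
    · refine ⟨Real.sqrt (1 - σ), Real.sq_sqrt (by linarith), ?_⟩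
      rw [h0, mul_zero]
      rw [h0] at hC
      rw [← hC] at hx
      refine (pow_eq_zero_iff two_ne_zero).1 ?_ |>.symm
      linear_combination -hx
    · refine ⟨x / Real.sqrt (1 - τ), ?_, div_mul_cancel₀ _ h0⟩
      have : (1 - τ) ≠ 0 := fun h1 => h0 (by rw [h1, Real.sqrt_zero])
      rw [div_pow, hC, ← hx]
      field_simp
  obtain ⟨u, hus, huc⟩ := exists_jacobi_eq hp2 (s := y / jacobiDn q v) (c := k)
    (by rw [hk, hs]; ring)
  refine ⟨u, v, by rw [huc, hvC, hkx], ?_, by rw [hvS]; exact hSr⟩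
  rw [hus]
  field_simp

theorem image_hyperboloidParam (h : HyperboloidModules a b c p q) :
    hyperboloidParam a b c p q '' dualDomain p q
      = hyperboloid a b c \ hyperboloidUmbilics a b c := by
  have ha := h.a_pos.ne'
  have hb := h.b_pos.ne'
  have hc := h.c_pos.ne'
  refine Set.Subset.antisymm ?_ ?_
  · rintro _ ⟨z, hz, rfl⟩
    exact ⟨hyperboloidParam_mem h hz.1, hyperboloidParam_notMem_umbilics h hz⟩
  · rintro P ⟨hP, hPu⟩
    simp only [hyperboloid, Set.mem_ofPred_eq] at hP
    have hr : P 2 / c ≠ 0 := by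
      intro h0
      rw [h0] at hP
      nlinarith [sq_nonneg (P 0 / a), sq_nonneg (P 1 / b)]
    have hP2 : P 2 ≠ 0 := fun h0 => hr (by rw [h0, zero_div])
    have hr2 : 0 < (P 2 / c) ^ 2 := by positivity
    obtain ⟨u, v, hx, hy, hpos⟩ := exists_jacobi_of_sum_lt_one h.p_pos h.q_pos h.pq
      (x := P 0 / a / (P 2 / c)) (y := P 1 / b / (P 2 / c)) (r := P 2 / c)
      (by rw [div_pow _ (P 2 / c), div_pow _ (P 2 / c), ← add_div, div_lt_one hr2]; linarith) hr
    have hS : jacobiSn q v ≠ 0 := fun h0 => by rw [h0, zero_mul] at hpos; exact lt_irrefl _ hpos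
    have hd := jacobiDn_pos h.p_sq_lt u
    have hsum := (h.jacobiValues u v).sq_sum
    -- The equation of the hyperboloid gives this only up to sign; the sign of sn v was chosen to
    -- select the right sheet.
    have hone : jacobiDn p u * (jacobiSn q v * (P 2 / c)) = 1 := by
      have hsq : (jacobiDn p u * (jacobiSn q v * (P 2 / c))) ^ 2 = 1 := by
        rw [← mul_pow, ← mul_pow, ← mul_pow, hx, hy, div_pow _ (P 2 / c), div_pow _ (P 2 / c)] at hsum
        have h3 : (P 2 / c) ^ 2 * ((P 0 / a) ^ 2 / (P 2 / c) ^ 2) = (P 0 / a) ^ 2 :=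
          mul_div_cancel₀ _ hr2.ne'
        have h4 : (P 2 / c) ^ 2 * ((P 1 / b) ^ 2 / (P 2 / c) ^ 2) = (P 1 / b) ^ 2 :=
          mul_div_cancel₀ _ hr2.ne'
        linear_combination (P 2 / c) ^ 2 * hsum - h3 - h4 - hP
      exact (pow_eq_one_iff_of_nonneg (mul_pos hd hpos).le two_ne_zero).1 hsq
    have hz : hyperboloidParam a b c p q ⟨u, v⟩ = P := by
      have hr' : P 2 / c = 1 / (jacobiDn p u * jacobiSn q v) := by
        field_simp
        field_simp at hone
        linear_combination hone
      have h2 : P 2 = c * (1 / (jacobiDn p u * jacobiSn q v)) := by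
        rw [← hr']; field_simp
      have h0 : P 0 = a * (P 2 / c) * (jacobiCn p u * jacobiCn q v) := by
        rw [hx]; field_simp
      have h1 : P 1 = b * (P 2 / c) * (jacobiSn p u * jacobiDn q v) := by
        rw [hy]; field_simp
      rw [hr'] at h0 h1
      ext i
      fin_cases i
      · simp [hyperboloidParam, h0]; field_simp
      · simp [hyperboloidParam, h1]; field_simp
      · simp [hyperboloidParam, h2]
        left
        field_simp
    refine ⟨⟨u, v⟩, ⟨hS, fun h0 => hPu ?_⟩, hz⟩
    rw [← hz]
    exact hyperboloidParam_mem_umbilics h hS h0.1 h0.2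

/-! ### Real parts of the values of `arctan` and `artanh` -/

theorem normSq_cos_mul (θ : ℂ) :
    Complex.normSq (Complex.cos θ) - Complex.normSq (Complex.sin θ) = Real.cos (2 * θ.re) ∧
    2 * (Complex.sin θ * (starRingEnd ℂ) (Complex.cos θ)).re = Real.sin (2 * θ.re) := by
  have hc : Complex.cos θ = ⟨Real.cos θ.re * Real.cosh θ.im, -(Real.sin θ.re * Real.sinh θ.im)⟩ := by
    rw [Complex.cos_eq]
    simp only [← Complex.ofReal_cos, ← Complex.ofReal_sin, ← Complex.ofReal_cosh,
      ← Complex.ofReal_sinh]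
    apply Complex.ext <;>
      simp only [Complex.sub_re, Complex.mul_re, Complex.sub_im, Complex.mul_im,
        Complex.ofReal_re, Complex.ofReal_im, Complex.I_re, Complex.I_im] <;>
      ring
  have hs : Complex.sin θ = ⟨Real.sin θ.re * Real.cosh θ.im, Real.cos θ.re * Real.sinh θ.im⟩ := by
    rw [Complex.sin_eq]
    simp only [← Complex.ofReal_cos, ← Complex.ofReal_sin, ← Complex.ofReal_cosh,
      ← Complex.ofReal_sinh]
    apply Complex.ext <;>
      simp only [Complex.add_re, Complex.mul_re, Complex.add_im, Complex.mul_im,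
        Complex.ofReal_re, Complex.ofReal_im, Complex.I_re, Complex.I_im] <;>
      ring
  have h1 := Real.cosh_sq θ.im
  rw [hc, hs, Real.cos_two_mul', Real.sin_two_mul]
  constructor
  · simp only [Complex.normSq_mk]
    linear_combination (Real.cos θ.re ^ 2 - Real.sin θ.re ^ 2) * h1
  · simp only [Complex.mul_re, Complex.conj_re, Complex.conj_im]
    linear_combination (2 * Real.cos θ.re * Real.sin θ.re) * h1

/-- Substitute sin θ = w cos θ in the double-angle formulas for 2 Re θ. Thus w alone fixes Re θ
modulo π. -/
theorem IsArctanValue.re_eqs {w θ : ℂ} (h : IsArctanValue w θ) :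
    (1 - Complex.normSq w) * Complex.normSq (Complex.cos θ) = Real.cos (2 * θ.re) ∧
    2 * w.re * Complex.normSq (Complex.cos θ) = Real.sin (2 * θ.re) := by
  obtain ⟨hc, rfl⟩ := h
  obtain ⟨h1, h2⟩ := normSq_cos_mul θ
  have hs : Complex.sin θ = Complex.tan θ * Complex.cos θ := by
    rw [Complex.tan_eq_sin_div_cos, div_mul_cancel₀ _ hc]
  rw [← h1, ← h2, hs, mul_assoc (Complex.tan θ), Complex.mul_conj, Complex.re_mul_ofReal,
    Complex.normSq_mul]
  constructor <;> ring

theorem isArtanhValue_iff {w θ : ℂ} :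
    IsArtanhValue w θ ↔ IsArctanValue (w * Complex.I) (θ * Complex.I) := by
  rw [IsArtanhValue, IsArctanValue, Complex.cos_mul_I, Complex.tan_mul_I]
  simp

theorem normSq_cosh_mul (θ : ℂ) :
    Complex.normSq (Complex.cosh θ) + Complex.normSq (Complex.sinh θ) = Real.cosh (2 * θ.re) ∧
    2 * (Complex.sinh θ * (starRingEnd ℂ) (Complex.cosh θ)).re = Real.sinh (2 * θ.re) := by
  have hc : Complex.cosh θ = ⟨Real.cosh θ.re * Real.cos θ.im, Real.sinh θ.re * Real.sin θ.im⟩ := by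
    conv_lhs => rw [← Complex.re_add_im θ]
    rw [Complex.cosh_add, Complex.cosh_mul_I, Complex.sinh_mul_I]
    simp only [← Complex.ofReal_cos, ← Complex.ofReal_sin, ← Complex.ofReal_cosh,
      ← Complex.ofReal_sinh]
    apply Complex.ext <;>
      simp only [Complex.add_re, Complex.mul_re, Complex.add_im, Complex.mul_im,
        Complex.ofReal_re, Complex.ofReal_im, Complex.I_re, Complex.I_im] <;>
      ring
  have hs : Complex.sinh θ = ⟨Real.sinh θ.re * Real.cos θ.im, Real.cosh θ.re * Real.sin θ.im⟩ := by
    conv_lhs => rw [← Complex.re_add_im θ]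
    rw [Complex.sinh_add, Complex.cosh_mul_I, Complex.sinh_mul_I]
    simp only [← Complex.ofReal_cos, ← Complex.ofReal_sin, ← Complex.ofReal_cosh,
      ← Complex.ofReal_sinh]
    apply Complex.ext <;>
      simp only [Complex.add_re, Complex.mul_re, Complex.add_im, Complex.mul_im,
        Complex.ofReal_re, Complex.ofReal_im, Complex.I_re, Complex.I_im] <;>
      ring
  have h1 := Real.sin_sq_add_cos_sq θ.im
  rw [hc, hs, Real.cosh_two_mul, Real.sinh_two_mul]
  constructor
  · simp only [Complex.normSq_mk]
    linear_combination (Real.cosh θ.re ^ 2 + Real.sinh θ.re ^ 2) * h1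
  · simp only [Complex.mul_re, Complex.conj_re, Complex.conj_im]
    linear_combination (2 * Real.cosh θ.re * Real.sinh θ.re) * h1

theorem IsArtanhValue.re_eqs {w θ : ℂ} (h : IsArtanhValue w θ) :
    (1 + Complex.normSq w) * Complex.normSq (Complex.cosh θ) = Real.cosh (2 * θ.re) ∧
    2 * w.re * Complex.normSq (Complex.cosh θ) = Real.sinh (2 * θ.re) := by
  obtain ⟨hc, rfl⟩ := h
  obtain ⟨h1, h2⟩ := normSq_cosh_mul θ
  have hs : Complex.sinh θ = Complex.tanh θ * Complex.cosh θ := by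
    rw [Complex.tanh_eq_sinh_div_cosh, div_mul_cancel₀ _ hc]
  rw [← h1, ← h2, hs, mul_assoc (Complex.tanh θ), Complex.mul_conj, Complex.re_mul_ofReal,
    Complex.normSq_mul]
  constructor <;> ring

theorem exists_isArctanValue {w : ℂ} (h₁ : w ≠ Complex.I) (h₂ : w ≠ -Complex.I) :
    ∃ θ, IsArctanValue w θ := by
  have h := Complex.tan_arctan h₁ h₂
  refine ⟨Complex.arctan w, fun h0 => ?_, h⟩
  -- Division by zero makes the tangent 0 where the cosine vanishes, so this case could only occur
  -- for w = 0, where arctan is 0 and its cosine is 1.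
  have hw : w = 0 := by rw [← h, Complex.tan_eq_sin_div_cos, h0, div_zero]
  rw [hw] at h0
  simp [Complex.arctan] at h0

theorem exists_isArtanhValue {w : ℂ} (h₁ : w ≠ 1) (h₂ : w ≠ -1) : ∃ θ, IsArtanhValue w θ := by
  obtain ⟨θ, hθ⟩ := exists_isArctanValue (w := w * Complex.I)
    (fun h => h₁ (mul_right_cancel₀ Complex.I_ne_zero (by rw [h, one_mul])))
    (fun h => h₂ (mul_right_cancel₀ Complex.I_ne_zero (by rw [h, neg_one_mul])))
  refine ⟨-θ * Complex.I, isArtanhValue_iff.2 ?_⟩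
  rwa [mul_assoc, Complex.I_mul_I, mul_neg_one, neg_neg]

theorem IsArctanValue.add_int_mul_pi {w θ : ℂ} (h : IsArctanValue w θ) (n : ℤ) :
    IsArctanValue w (θ + n * Real.pi) := by
  refine ⟨?_, ?_⟩
  · rw [Complex.cos_antiperiodic.add_int_mul_eq n]
    exact mul_ne_zero (by simp) h.1
  · rw [Complex.tan_periodic.int_mul n θ]
    exact h.2

/-- The hypotheses say that (1 - |w|²) + 2i Re w = -k (A + iB)². So exp(2i Re θ) is a negative
multiple of (A + iB)², that is, exp(i Re θ) is orthogonal to A + iB. Both sides of the equivalence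
are invariant under t ↦ t + π, which gives the converse. -/
theorem exists_isArctanValue_re_iff {w : ℂ} {A B k t : ℝ} (hk : 0 < k)
    (hN : 0 < A ^ 2 + B ^ 2) (h₁ : 1 - Complex.normSq w = -k * (A ^ 2 - B ^ 2))
    (h₂ : w.re = -k * (A * B)) :
    (∃ θ, IsArctanValue w θ ∧ θ.re = t) ↔ A * Real.cos t + B * Real.sin t = 0 := by
  have key : ∀ θ, IsArctanValue w θ → A * Real.cos θ.re + B * Real.sin θ.re = 0 := by
    intro θ hθ
    obtain ⟨e1, e2⟩ := hθ.re_eqs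
    have hm : 0 < k * Complex.normSq (Complex.cos θ) := mul_pos hk (Complex.normSq_pos.2 hθ.1)
    rw [h₁] at e1
    rw [h₂] at e2
    generalize hm' : k * Complex.normSq (Complex.cos θ) = m at hm
    have e1' : Real.cos (2 * θ.re) = -m * (A ^ 2 - B ^ 2) := by rw [← e1, ← hm']; ring
    have e2' : Real.sin (2 * θ.re) = -m * (2 * A * B) := by rw [← e2, ← hm']; ring
    have e3 := Real.sin_sq_add_cos_sq (2 * θ.re)
    have e4 : m * (A ^ 2 + B ^ 2) = 1 := by
      refine (pow_eq_one_iff_of_nonneg (by positivity) two_ne_zero).1 ?_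
      rw [e1', e2'] at e3
      linear_combination e3
    rw [Real.cos_two_mul'] at e1'
    rw [Real.sin_two_mul] at e2'
    have e5 := Real.sin_sq_add_cos_sq θ.re
    refine (pow_eq_zero_iff two_ne_zero).1 ?_
    linear_combination ((A ^ 2 + B ^ 2) / 2) * e5 + ((A ^ 2 - B ^ 2) / 2) * e1' + A * B * e2'
      - (A ^ 2 + B ^ 2) / 2 * e4
  constructor
  · rintro ⟨θ, hθ, rfl⟩
    exact key θ hθ
  · intro ht
    -- At w = ±i both A² = B² and AB = 0, contradicting A² + B² > 0.
    have hw : ∀ {ε : ℝ}, ε ^ 2 = 1 → w ≠ ε * Complex.I := by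
      intro ε hε hw
      rw [hw, Complex.normSq_mul, Complex.normSq_ofReal, Complex.normSq_I, ← pow_two, hε] at h₁
      rw [hw] at h₂
      simp at h₁ h₂
      have h3 : (A ^ 2 + B ^ 2) ^ 2 = 0 := by
        rcases h₂ with h2 | h2 | h2
        · exact absurd h2 hk.ne'
        · rcases h₁ with h1 | h1
          · exact absurd h1 hk.ne'
          · rw [h2] at h1 ⊢; linear_combination (-B ^ 2) * h1
        · rcases h₁ with h1 | h1
          · exact absurd h1 hk.ne'
          · rw [h2] at h1 ⊢; linear_combination (A ^ 2) * h1
      exact hN.ne' ((pow_eq_zero_iff two_ne_zero).1 h3)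
    obtain ⟨θ, hθ⟩ := exists_isArctanValue (w := w) (by simpa using hw (ε := 1) (by norm_num))
      (by simpa using hw (ε := -1) (by norm_num))
    have hk' := key θ hθ
    have hsin : Real.sin (t - θ.re) = 0 := by
      apply mul_left_cancel₀ hN.ne'
      rw [Real.sin_sub]
      linear_combination (A * Real.sin t - B * Real.cos t) * hk'
        - (A * Real.sin θ.re - B * Real.cos θ.re) * ht
    obtain ⟨n, hn⟩ := Real.sin_eq_zero_iff.1 hsin
    refine ⟨θ + n * Real.pi, hθ.add_int_mul_pi n, ?_⟩
    have : ((n : ℂ) * Real.pi).re = n * Real.pi := by simp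
    rw [Complex.add_re, this, hn]
    ring

/-- Here tanh(2 Re θ) = 2EF / (E² + F²), the double-argument formula for tanh(Re θ) = F/E. The other
root E/F is excluded by |F| < E. The real part is single-valued because the periods of tanh are
imaginary. -/
theorem exists_isArtanhValue_re_iff {w : ℂ} {E F k t : ℝ} (hk : 0 < k) (hE : 0 < E)
    (hF : F ^ 2 < E ^ 2) (h₁ : 1 + Complex.normSq w = k * (E ^ 2 + F ^ 2))
    (h₂ : w.re = k * (E * F)) :
    (∃ θ, IsArtanhValue w θ ∧ θ.re = t) ↔ t = Real.artanh (F / E) := by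
  have key : ∀ θ, IsArtanhValue w θ → θ.re = Real.artanh (F / E) := by
    intro θ hθ
    obtain ⟨e1, e2⟩ := hθ.re_eqs
    rw [h₁, Real.cosh_two_mul] at e1
    rw [h₂, Real.sinh_two_mul] at e2
    have hlt := abs_lt_of_sq_lt_sq hF hE.le
    have hch := Real.cosh_pos θ.re
    have hprod : (E * Real.sinh θ.re - F * Real.cosh θ.re)
        * (E * Real.cosh θ.re - F * Real.sinh θ.re) = 0 := by
      linear_combination E * F * e1 - (E ^ 2 + F ^ 2) / 2 * e2
    have hpos : 0 < E * Real.cosh θ.re - F * Real.sinh θ.re := by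
      have hsh : |Real.sinh θ.re| ≤ Real.cosh θ.re :=
        abs_le.2 ⟨by linarith [Real.cosh_add_sinh θ.re, Real.exp_pos θ.re],
          (Real.sinh_lt_cosh θ.re).le⟩
      have h3 : F * Real.sinh θ.re ≤ |F| * Real.cosh θ.re := by
        calc F * Real.sinh θ.re ≤ |F * Real.sinh θ.re| := le_abs_self _
          _ = |F| * |Real.sinh θ.re| := abs_mul _ _
          _ ≤ |F| * Real.cosh θ.re := by gcongr
      nlinarith
    rcases mul_eq_zero.1 hprod with h0 | h0
    · have ht : F / E = Real.tanh θ.re := by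
        rw [Real.tanh_eq_sinh_div_cosh, div_eq_div_iff hE.ne' hch.ne']
        linear_combination -h0
      rw [ht, Real.artanh_tanh]
    · exact absurd h0 hpos.ne'
  constructor
  · rintro ⟨θ, hθ, rfl⟩
    exact key θ hθ
  · rintro rfl
    have hw : ∀ {ε : ℝ}, ε ^ 2 = 1 → w ≠ ε := by
      intro ε hε hw
      rw [hw, Complex.normSq_ofReal, ← pow_two, hε] at h₁
      rw [hw, Complex.ofReal_re] at h₂
      have h3 : k * (E - ε * F) ^ 2 = 0 := by
        linear_combination k * F ^ 2 * hε - h₁ + 2 * ε * h₂ - 2 * hε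
      rcases mul_eq_zero.1 h3 with h4 | h4
      · exact hk.ne' h4
      · have h5 : E = ε * F := sub_eq_zero.1 ((pow_eq_zero_iff two_ne_zero).1 h4)
        rw [h5, mul_pow, hε, one_mul] at hF
        exact lt_irrefl _ hF
    obtain ⟨θ, hθ⟩ := exists_isArtanhValue (w := w) (by simpa using hw (ε := 1) (by norm_num))
      (by simpa using hw (ε := -1) (by norm_num))
    exact ⟨θ, hθ, key θ hθ⟩

/-! ### The branches of the dual in terms of the real Jacobi functions -/

namespace JacobiValues

variable {s d S C D : ℝ}

theorem sq_add_sq_pos (h : JacobiValues p q s c d S C D) (hS : S ≠ 0) :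
    0 < s ^ 2 * D ^ 2 + d ^ 2 * S ^ 2 := by
  have := h.d_pos
  positivity

theorem one_sub_sq_pos (h : JacobiValues p q s c d S C D) (hS : S ≠ 0) :
    0 < 1 - s ^ 2 * D ^ 2 := by
  have := h.d_pos
  have e : 1 - s ^ 2 * D ^ 2 = d ^ 2 * S ^ 2 + c ^ 2 * C ^ 2 := by linear_combination -h.sq_sum
  rw [e]
  positivity

/-- Numerator of `|sn (u + i v)|²`. -/
theorem normSq_sn (h : JacobiValues p q s c d S C D) :
    (s * D) ^ 2 + (c * d * S * C) ^ 2
      = (C ^ 2 + p ^ 2 * s ^ 2 * S ^ 2) * (s ^ 2 * D ^ 2 + d ^ 2 * S ^ 2) := by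
  simp only [mul_pow]
  rw [h.c_sq, h.C_sq, h.d_sq, h.D_sq, show q ^ 2 = 1 - p ^ 2 by linear_combination h.pq]
  ring

/-- Numerator of `|cn (u + i v)|²`. -/
theorem normSq_cn (h : JacobiValues p q s c d S C D) :
    (c * C) ^ 2 + (s * d * S * D) ^ 2
      = (C ^ 2 + p ^ 2 * s ^ 2 * S ^ 2) * (1 - s ^ 2 * D ^ 2) := by
  simp only [mul_pow]
  rw [h.c_sq, h.C_sq, h.d_sq, h.D_sq, show q ^ 2 = 1 - p ^ 2 by linear_combination h.pq]
  ring

/-- This and the next two identities are the numerators of 1 - |w|² or 1 + |w|² for the three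
arguments w. They exhibit the pairs (A, B) and (E, F) needed by the two equivalences for real parts.
-/
theorem one_sub_normSq_arctan (h : JacobiValues p q s c d S C D) :
    p ^ 2 * (s ^ 2 * D ^ 2 + d ^ 2 * S ^ 2) - (C ^ 2 + p ^ 2 * s ^ 2 * S ^ 2)
      = -((d * C) ^ 2 - (p * c * S) ^ 2) := by
  simp only [mul_pow]
  rw [h.c_sq, h.C_sq, h.d_sq, h.D_sq, show q ^ 2 = 1 - p ^ 2 by linear_combination h.pq]
  ring

theorem one_add_normSq_artanh₁ (h : JacobiValues p q s c d S C D) :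
    p ^ 2 * (1 - s ^ 2 * D ^ 2) + q ^ 2 * (C ^ 2 + p ^ 2 * s ^ 2 * S ^ 2)
      = (d * D) ^ 2 + (p * q * (s * S)) ^ 2 := by
  simp only [mul_pow]
  rw [h.C_sq, h.d_sq, h.D_sq]
  linear_combination h.pq

theorem one_add_normSq_artanh₂ (h : JacobiValues p q s c d S C D) :
    1 - s ^ 2 * D ^ 2 + q ^ 2 * (s ^ 2 * D ^ 2 + d ^ 2 * S ^ 2) = d ^ 2 + (q * S) ^ 2 := by
  simp only [mul_pow]
  rw [h.d_sq, h.D_sq, show q ^ 2 = 1 - p ^ 2 by linear_combination h.pq]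
  ring

end JacobiValues

namespace HyperboloidModules

theorem compModule_eq (h : HyperboloidModules a b c p q) : compModule p = q := by
  rw [compModule, show 1 - p ^ 2 = q ^ 2 by linear_combination -h.pq, Real.sqrt_sq h.q_pos.le]

theorem jacobiDenom_eq (h : HyperboloidModules a b c p q) (z : ℂ) :
    jacobiDenom p z = jacobiCn q z.im ^ 2 + p ^ 2 * jacobiSn p z.re ^ 2 * jacobiSn q z.im ^ 2 := by
  rw [jacobiDenom, h.compModule_eq]

theorem jacobiSnC_eq (h : HyperboloidModules a b c p q) (z : ℂ) :
    jacobiSnC p z = ⟨jacobiSn p z.re * jacobiDn q z.im / jacobiDenom p z,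
      jacobiCn p z.re * jacobiDn p z.re * jacobiSn q z.im * jacobiCn q z.im
        / jacobiDenom p z⟩ := by
  rw [jacobiSnC, h.compModule_eq]
  apply Complex.ext
  · rw [Complex.div_ofReal_re]; simp
  · rw [Complex.div_ofReal_im]; simp

theorem jacobiCnC_eq (h : HyperboloidModules a b c p q) (z : ℂ) :
    jacobiCnC p z = ⟨jacobiCn p z.re * jacobiCn q z.im / jacobiDenom p z,
      -(jacobiSn p z.re * jacobiDn p z.re * jacobiSn q z.im * jacobiDn q z.im)
        / jacobiDenom p z⟩ := by
  rw [jacobiCnC, h.compModule_eq]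
  apply Complex.ext
  · rw [Complex.div_ofReal_re]; simp
  · rw [Complex.div_ofReal_im]; simp

variable {z : ℂ}

/-- Since |sn|² = M/Δ with Δ = `jacobiDenom`, the reciprocal of sn is its conjugate times Δ/M. So Δ
cancels, and M > 0 because S ≠ 0. -/
theorem arctan_arg_eq (h : HyperboloidModules a b c p q) (hS : jacobiSn q z.im ≠ 0)
    (hz : ¬ IsJacobiPole p z) :
    1 / (Complex.I * p * jacobiSnC p z)
      = ⟨-(jacobiCn p z.re * jacobiDn p z.re * jacobiSn q z.im * jacobiCn q z.im)
          / (p * (jacobiSn p z.re ^ 2 * jacobiDn q z.im ^ 2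
            + jacobiDn p z.re ^ 2 * jacobiSn q z.im ^ 2)),
        -(jacobiSn p z.re * jacobiDn q z.im)
          / (p * (jacobiSn p z.re ^ 2 * jacobiDn q z.im ^ 2
            + jacobiDn p z.re ^ 2 * jacobiSn q z.im ^ 2))⟩ := by
  have hJ := h.jacobiValues z.re z.im
  have hM := (hJ.sq_add_sq_pos hS).ne'
  have hn := hJ.normSq_sn
  have hp := h.p_pos.ne'
  rw [IsJacobiPole] at hz
  rw [h.jacobiSnC_eq]
  rw [← h.jacobiDenom_eq] at hn
  generalize jacobiDenom p z = Δ at *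
  refine (eq_one_div_of_mul_eq_one_left ?_).symm
  generalize jacobiSn p z.re ^ 2 * jacobiDn q z.im ^ 2
    + jacobiDn p z.re ^ 2 * jacobiSn q z.im ^ 2 = M at *
  apply Complex.ext
  · simp
    field_simp
    linear_combination hn
  · simp
    field_simp
    ring

theorem artanh_arg₁_eq (h : HyperboloidModules a b c p q) (hS : jacobiSn q z.im ≠ 0)
    (hz : ¬ IsJacobiPole p z) :
    q / (Complex.I * p * jacobiCnC p z)
      = ⟨q * (jacobiSn p z.re * jacobiDn p z.re * jacobiSn q z.im * jacobiDn q z.im)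
          / (p * (1 - jacobiSn p z.re ^ 2 * jacobiDn q z.im ^ 2)),
        -q * (jacobiCn p z.re * jacobiCn q z.im)
          / (p * (1 - jacobiSn p z.re ^ 2 * jacobiDn q z.im ^ 2))⟩ := by
  have hJ := h.jacobiValues z.re z.im
  have hR := (hJ.one_sub_sq_pos hS).ne'
  have hn := hJ.normSq_cn
  have hp := h.p_pos.ne'
  rw [IsJacobiPole] at hz
  rw [h.jacobiCnC_eq]
  rw [← h.jacobiDenom_eq] at hn
  generalize jacobiDenom p z = Δ at *
  generalize 1 - jacobiSn p z.re ^ 2 * jacobiDn q z.im ^ 2 = R at *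
  have hmul : (⟨q * (jacobiSn p z.re * jacobiDn p z.re * jacobiSn q z.im * jacobiDn q z.im)
          / (p * R), -q * (jacobiCn p z.re * jacobiCn q z.im) / (p * R)⟩ : ℂ)
      * (Complex.I * p * ⟨jacobiCn p z.re * jacobiCn q z.im / Δ,
        -(jacobiSn p z.re * jacobiDn p z.re * jacobiSn q z.im * jacobiDn q z.im) / Δ⟩) = q := by
    apply Complex.ext
    · simp
      field_simp
      linear_combination q * hn
    · simp
      field_simp
      ring
  rw [div_eq_iff, hmul]
  intro h0
  rw [h0, mul_zero] at hmul
  exact h.q_pos.ne' (Complex.ofReal_eq_zero.1 hmul.symm)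

theorem artanh_arg₂_eq (h : HyperboloidModules a b c p q) (hS : jacobiSn q z.im ≠ 0)
    (hz : ¬ IsJacobiPole p z) :
    q / Complex.I * (jacobiSnC p z / jacobiCnC p z)
      = ⟨q * (jacobiDn p z.re * jacobiSn q z.im)
          / (1 - jacobiSn p z.re ^ 2 * jacobiDn q z.im ^ 2),
        -q * (jacobiSn p z.re * jacobiCn p z.re * jacobiCn q z.im * jacobiDn q z.im)
          / (1 - jacobiSn p z.re ^ 2 * jacobiDn q z.im ^ 2)⟩ := by
  have hJ := h.jacobiValues z.re z.im
  have hR := (hJ.one_sub_sq_pos hS).ne'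
  have hsum := hJ.sq_sum
  have hn := hJ.normSq_cn
  have hp := h.p_pos.ne'
  have hcn : jacobiCnC p z ≠ 0 := by
    intro h0
    rw [h.jacobiCnC_eq] at h0
    have hre := congrArg Complex.re h0
    have him := congrArg Complex.im h0
    rw [IsJacobiPole] at hz
    simp only [Complex.zero_re, Complex.zero_im, div_eq_zero_iff, hz, or_false, neg_eq_zero]
      at hre him
    rw [hre, him, ← h.jacobiDenom_eq] at hn
    have := mul_ne_zero hz hR
    apply this
    rw [← hn]
    ring
  rw [IsJacobiPole] at hz
  have hmul : jacobiSnC p z / jacobiCnC p z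
      = ⟨jacobiSn p z.re * jacobiCn p z.re * jacobiCn q z.im * jacobiDn q z.im
          / (1 - jacobiSn p z.re ^ 2 * jacobiDn q z.im ^ 2),
        jacobiDn p z.re * jacobiSn q z.im
          / (1 - jacobiSn p z.re ^ 2 * jacobiDn q z.im ^ 2)⟩ := by
    rw [div_eq_iff hcn, h.jacobiSnC_eq, h.jacobiCnC_eq]
    generalize jacobiDenom p z = Δ at *
    apply Complex.ext
    · simp
      field_simp
      linear_combination (-jacobiSn p z.re * jacobiDn q z.im) * hsum
    · simp
      field_simp
      ring
  rw [hmul]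
  apply Complex.ext
  · simp; ring
  · simp; ring

end HyperboloidModules

theorem exists_arctan_re_iff (h : HyperboloidModules a b c p q) {z : ℂ} (hz : z ∈ dualDomain p q)
    (hp : ¬ IsJacobiPole p z) (t : ℝ) :
    (∃ θ, IsArctanValue (1 / (Complex.I * p * jacobiSnC p z)) θ ∧ θ.re = t) ↔
      jacobiDn p z.re * jacobiCn q z.im * Real.cos t
        + p * jacobiCn p z.re * jacobiSn q z.im * Real.sin t = 0 := by
  have hJ := h.jacobiValues z.re z.im
  have hM := hJ.sq_add_sq_pos hz.1
  have hN := hJ.norm_pos hz.2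
  have hp0 := h.p_pos
  have hn := hJ.normSq_sn
  have h1 := hJ.one_sub_normSq_arctan
  rw [h.arctan_arg_eq hz.1 hp]
  refine exists_isArctanValue_re_iff
    (k := 1 / (p ^ 2 * (jacobiSn p z.re ^ 2 * jacobiDn q z.im ^ 2
      + jacobiDn p z.re ^ 2 * jacobiSn q z.im ^ 2))) (by positivity) ?_ ?_ ?_
  · rw [hJ.norm_eq₁] at hN
    linarith
  · rw [Complex.normSq_mk]
    generalize jacobiSn p z.re ^ 2 * jacobiDn q z.im ^ 2
      + jacobiDn p z.re ^ 2 * jacobiSn q z.im ^ 2 = M at *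
    field_simp
    linear_combination -hn + M * h1
  · field_simp

theorem exists_artanh_re_iff₁ (h : HyperboloidModules a b c p q) {z : ℂ}
    (hz : z ∈ dualDomain p q) (hp : ¬ IsJacobiPole p z) (t : ℝ) :
    (∃ θ, IsArtanhValue (q / (Complex.I * p * jacobiCnC p z)) θ ∧ θ.re = t) ↔
      t = Real.artanh (p * q * (jacobiSn p z.re * jacobiSn q z.im)
        / (jacobiDn p z.re * jacobiDn q z.im)) := by
  have hJ := h.jacobiValues z.re z.im
  have hR := hJ.one_sub_sq_pos hz.1
  have hN := hJ.norm_pos hz.2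
  have hp0 := h.p_pos
  have hn := hJ.normSq_cn
  have h1 := hJ.one_add_normSq_artanh₁
  rw [h.artanh_arg₁_eq hz.1 hp]
  refine exists_isArtanhValue_re_iff
    (k := 1 / (p ^ 2 * (1 - jacobiSn p z.re ^ 2 * jacobiDn q z.im ^ 2))) (by positivity)
    (mul_pos hJ.d_pos hJ.D_pos) ?_ ?_ ?_
  · have e : (jacobiDn p z.re * jacobiDn q z.im) ^ 2
        - (p * q * (jacobiSn p z.re * jacobiSn q z.im)) ^ 2
        = jacobiDn q z.im ^ 2 - p ^ 2 * jacobiSn p z.re ^ 2 := by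
      simp only [mul_pow]
      rw [hJ.d_sq, hJ.D_sq]
      ring
    linarith
  · rw [Complex.normSq_mk]
    generalize 1 - jacobiSn p z.re ^ 2 * jacobiDn q z.im ^ 2 = R at *
    field_simp
    linear_combination q ^ 2 * hn + R * h1
  · field_simp

theorem exists_artanh_re_iff₂ (h : HyperboloidModules a b c p q) {z : ℂ}
    (hz : z ∈ dualDomain p q) (hp : ¬ IsJacobiPole p z) (t : ℝ) :
    (∃ θ, IsArtanhValue (q / Complex.I * (jacobiSnC p z / jacobiCnC p z)) θ ∧ θ.re = t) ↔
      t = Real.artanh (q * jacobiSn q z.im / jacobiDn p z.re) := by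
  have hJ := h.jacobiValues z.re z.im
  have hR := hJ.one_sub_sq_pos hz.1
  have hN := hJ.norm_pos hz.2
  have hsum := hJ.sq_sum
  have h1 := hJ.one_add_normSq_artanh₂
  rw [h.artanh_arg₂_eq hz.1 hp]
  refine exists_isArtanhValue_re_iff
    (k := 1 / (1 - jacobiSn p z.re ^ 2 * jacobiDn q z.im ^ 2)) (by positivity) hJ.d_pos ?_ ?_ ?_
  · have e := hJ.norm_eq₄
    rw [mul_pow]
    linarith
  · rw [Complex.normSq_mk]
    have e : (jacobiDn p z.re * jacobiSn q z.im) ^ 2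
        + (jacobiSn p z.re * jacobiCn p z.re * jacobiCn q z.im * jacobiDn q z.im) ^ 2
        = (1 - jacobiSn p z.re ^ 2 * jacobiDn q z.im ^ 2)
          * (jacobiSn p z.re ^ 2 * jacobiDn q z.im ^ 2
            + jacobiDn p z.re ^ 2 * jacobiSn q z.im ^ 2) := by
      linear_combination (jacobiSn p z.re ^ 2 * jacobiDn q z.im ^ 2) * hsum
    generalize 1 - jacobiSn p z.re ^ 2 * jacobiDn q z.im ^ 2 = R at *
    field_simp
    linear_combination q ^ 2 * e + R * h1
  · field_simp

/-! ### Regularity of the branches of the dual -/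

theorem hasDerivAt_artanh {x : ℝ} (hx : x ^ 2 < 1) :
    HasDerivAt Real.artanh (1 / (1 - x ^ 2)) x ∧ ContDiffAt ℝ (⊤ : ℕ∞) Real.artanh x := by
  have habs := abs_lt.1 ((sq_lt_one_iff_abs_lt_one x).1 hx)
  have h1 : 0 < 1 + x := by linarith
  have h2 : 0 < 1 - x := by linarith
  have he : Real.artanh =ᶠ[nhds x] fun y => 1 / 2 * Real.log ((1 + y) / (1 - y)) := by
    filter_upwards [Ioo_mem_nhds habs.1 habs.2] with y hy
    exact Real.artanh_eq_half_log ⟨hy.1.le, hy.2.le⟩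
  constructor
  · refine HasDerivAt.congr_of_eventuallyEq ?_ he
    have h3 := ((((hasDerivAt_id x).const_add 1).div ((hasDerivAt_id x).const_sub 1) h2.ne').log
      (div_pos h1 h2).ne').const_mul (1 / 2)
    refine h3.congr_deriv ?_
    have h4 : 1 - x ^ 2 ≠ 0 := by linarith
    simp only [id, Pi.div_apply]
    field_simp
    ring
  · refine ContDiffAt.congr_of_eventuallyEq ?_ he
    exact contDiffAt_const.mul (((contDiffAt_const.add contDiffAt_id).div
      (contDiffAt_const.sub contDiffAt_id) h2.ne').log (div_pos h1 h2).ne')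

/-- A continuous function `t` with `A cos t + B sin t = 0` is locally an arctangent. -/
theorem contDiffAt_angle {A B t : ℂ → ℝ} {z : ℂ} (hA : ContDiffAt ℝ (⊤ : ℕ∞) A z)
    (hB : ContDiffAt ℝ (⊤ : ℕ∞) B z) (ht : ContinuousAt t z)
    (h : ∀ᶠ w in nhds z, A w * Real.cos (t w) + B w * Real.sin (t w) = 0)
    (hAB : 0 < A z ^ 2 + B z ^ 2) : ContDiffAt ℝ (⊤ : ℕ∞) t z := by
  -- Rotating (A, B) by the angle t(z) turns the equation into P cos δ + Q sin δ = 0 for δ = t -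
  -- t(z). As P(z) = 0 and Q(z) ≠ 0, near z the small angle δ is arctan(-P/Q).
  set P : ℂ → ℝ := fun w => A w * Real.cos (t z) + B w * Real.sin (t z) with hP
  set Q : ℂ → ℝ := fun w => B w * Real.cos (t z) - A w * Real.sin (t z) with hQ
  have hPc : ContDiffAt ℝ (⊤ : ℕ∞) P z := (hA.mul contDiffAt_const).add (hB.mul contDiffAt_const)
  have hQc : ContDiffAt ℝ (⊤ : ℕ∞) Q z := (hB.mul contDiffAt_const).sub (hA.mul contDiffAt_const)
  have hQz : Q z ≠ 0 := by
    intro h0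
    have h1 : P z = 0 := h.self_of_nhds
    have h2 := Real.sin_sq_add_cos_sq (t z)
    have h3 : A z ^ 2 + B z ^ 2 = P z ^ 2 + Q z ^ 2 := by
      simp only [hP, hQ]
      linear_combination -(A z ^ 2 + B z ^ 2) * h2
    rw [h3, h0, h1] at hAB
    simp at hAB
  have hQne : ∀ᶠ w in nhds z, Q w ≠ 0 := hQc.continuousAt.eventually_ne hQz
  have hlt : ∀ᶠ w in nhds z, t w - t z ∈ Set.Ioo (-(Real.pi / 2)) (Real.pi / 2) := by
    have hc : ContinuousAt (fun w => t w - t z) z := ht.sub continuousAt_const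
    refine hc.eventually_mem (Ioo_mem_nhds ?_ ?_) <;> simp [Real.pi_pos]
  have he : t =ᶠ[nhds z] fun w => t z + Real.arctan (-P w / Q w) := by
    filter_upwards [h, hQne, hlt] with w hw hQw hlw
    have hcos := Real.cos_pos_of_mem_Ioo hlw
    have e1 : P w * Real.cos (t w - t z) + Q w * Real.sin (t w - t z) = 0 := by
      have h2 := Real.sin_sq_add_cos_sq (t z)
      rw [Real.cos_sub, Real.sin_sub]
      simp only [hP, hQ]
      linear_combination (A w * Real.cos (t w) + B w * Real.sin (t w)) * h2 + hw
    have e2 : -P w / Q w = Real.tan (t w - t z) := by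
      rw [Real.tan_eq_sin_div_cos, div_eq_div_iff hQw hcos.ne']
      linear_combination -e1
    rw [e2, Real.arctan_tan hlw.1 hlw.2]
    ring
  refine ContDiffAt.congr_of_eventuallyEq ?_ he
  exact contDiffAt_const.add (hPc.neg.div hQc hQz).arctan

/-- Modulo π, t is arg(A + iB) + π/2, and d arg = (A dB - B dA) / (A² + B²). -/
theorem HasPartials.angle {A B t : ℂ → ℝ} {z : ℂ} {Au Av Bu Bv : ℝ} (hA : HasPartials A Au Av z)
    (hB : HasPartials B Bu Bv z) (ht : DifferentiableAt ℝ t z)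
    (h : ∀ᶠ w in nhds z, A w * Real.cos (t w) + B w * Real.sin (t w) = 0)
    (hAB : 0 < A z ^ 2 + B z ^ 2) :
    HasPartials t ((A z * Bu - B z * Au) / (A z ^ 2 + B z ^ 2))
      ((A z * Bv - B z * Av) / (A z ^ 2 + B z ^ 2)) z := by
  have ht' : HasPartials t (fderiv ℝ t z 1) (fderiv ℝ t z Complex.I) z := by
    refine ht.hasFDerivAt.congr_fderiv ?_
    ext w
    have hw : w = w.re • (1 : ℂ) + w.im • Complex.I := by apply Complex.ext <;> simp
    conv_lhs => rw [hw, map_add, map_smul, map_smul]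
    simp
    ring
  have hF := (hA.mul ((Real.hasDerivAt_cos (t z)).comp_hasPartials ht')).add
    (hB.mul ((Real.hasDerivAt_sin (t z)).comp_hasPartials ht'))
  have h0 : HasFDerivAt (fun w => A w * Real.cos (t w) + B w * Real.sin (t w))
      (0 : ℂ →L[ℝ] ℝ) z :=
    (hasFDerivAt_const (0 : ℝ) z).congr_of_eventuallyEq h
  have hu := HasFDerivAt.unique hF h0
  have h1 := congrArg (fun L : ℂ →L[ℝ] ℝ => L 1) hu
  have h2 := congrArg (fun L : ℂ →L[ℝ] ℝ => L Complex.I) hu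
  simp at h1 h2
  have hz : A z * Real.cos (t z) + B z * Real.sin (t z) = 0 := h.self_of_nhds
  have hsc := Real.sin_sq_add_cos_sq (t z)
  have key : ∀ {α β τ : ℝ}, A z * (Real.sin (t z) * τ) = α * Real.cos (t z)
      + B z * (Real.cos (t z) * τ) + β * Real.sin (t z) →
      τ = (A z * β - B z * α) / (A z ^ 2 + B z ^ 2) := by
    intro α β τ he
    rw [eq_div_iff hAB.ne']
    have e1 : (A z * Real.sin (t z) - B z * Real.cos (t z)) * Real.sin (t z) = A z := by
      linear_combination A z * hsc - Real.cos (t z) * hz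
    have e2 : (A z * Real.sin (t z) - B z * Real.cos (t z)) * Real.cos (t z) = -B z := by
      linear_combination Real.sin (t z) * hz - B z * hsc
    linear_combination (A z * Real.sin (t z) - B z * Real.cos (t z)) * he
      + (α + τ * B z) * e2 + (β - τ * A z) * e1
  refine ht'.congr (key ?_) (key ?_)
  · linear_combination -h1
  · linear_combination -h2

/-- At a zero of sn the derivative cn · dn is nonzero, so sn vanishes on no open set. Poles in the
domain have sn_p u = 0, so identities proved off this set extend over the poles by continuity. -/
theorem dense_jacobiSn_ne_zero {k : ℝ} (hk : k ^ 2 < 1) :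
    Dense {z : ℂ | jacobiSn k z.re ≠ 0} := by
  have h : Dense {u : ℝ | jacobiSn k u ≠ 0} := by
    intro u
    rw [mem_closure_iff_frequently]
    intro hu
    have he : jacobiSn k =ᶠ[nhds u] fun _ => 0 := by
      filter_upwards [hu] with w hw
      by_contra h0
      exact hw h0
    have h0 := he.deriv_eq
    rw [(hasDerivAt_jacobiSn hk u).deriv, deriv_const] at h0
    have hs : jacobiSn k u = 0 := he.self_of_nhds
    have hc := jacobiCn_sq k u
    rcases mul_eq_zero.1 h0 with h1 | h1
    · rw [h1, hs] at hc; norm_num at hc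
    · exact (jacobiDn_pos hk u).ne' h1
  exact h.preimage Complex.isOpenMap_re

/-- The second component of the dual, up to a factor. -/
noncomputable def dualComp₁ (p q : ℝ) (z : ℂ) : ℝ :=
  Real.artanh (p * q * (jacobiSn p z.re * jacobiSn q z.im) / (jacobiDn p z.re * jacobiDn q z.im))

/-- The third component of the dual, up to a factor. -/
noncomputable def dualComp₂ (p q : ℝ) (z : ℂ) : ℝ :=
  Real.artanh (q * jacobiSn q z.im / jacobiDn p z.re)

/-- `jacobiNorm p q z` is `|dn z|²` up to a nonvanishing factor. -/
noncomputable def jacobiNorm (p q : ℝ) (z : ℂ) : ℝ :=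
  jacobiDn q z.im ^ 2 - p ^ 2 * jacobiSn p z.re ^ 2

theorem contDiff_re {f : ℝ → ℝ} (hf : ContDiff ℝ (⊤ : ℕ∞) f) :
    ContDiff ℝ (⊤ : ℕ∞) fun z : ℂ => f z.re := hf.comp Complex.reCLM.contDiff

theorem contDiff_im {f : ℝ → ℝ} (hf : ContDiff ℝ (⊤ : ℕ∞) f) :
    ContDiff ℝ (⊤ : ℕ∞) fun z : ℂ => f z.im := hf.comp Complex.imCLM.contDiff

/-- Since (d D)² - (p q s S)² = N, the derivative of artanh contributes exactly the factor 1/N. The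
same happens for `dualComp₂` through d² - q² S² = N. -/
theorem dualComp₁_regular (h : HyperboloidModules a b c p q) {z : ℂ} (hz : z ∈ dualDomain p q) :
    ContDiffAt ℝ (⊤ : ℕ∞) (dualComp₁ p q) z ∧
    HasPartials (dualComp₁ p q)
      (p * q * jacobiSn q z.im * (jacobiCn p z.re * jacobiDn q z.im) / jacobiNorm p q z)
      (p * q * jacobiDn p z.re * (jacobiSn p z.re * jacobiCn q z.im) / jacobiNorm p q z) z := by
  have hp := h.p_sq_lt
  have hq := h.q_sq_lt
  have hJ := h.jacobiValues z.re z.im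
  have hN := hJ.norm_pos hz.2
  have hd := hJ.d_pos
  have hD := hJ.D_pos
  have e : (jacobiDn p z.re * jacobiDn q z.im) ^ 2
      - (p * q * (jacobiSn p z.re * jacobiSn q z.im)) ^ 2 = jacobiNorm p q z := by
    simp only [mul_pow, jacobiNorm]
    rw [hJ.d_sq, hJ.D_sq]
    ring
  have hN' : 0 < jacobiNorm p q z := hN
  have hlt : (p * q * (jacobiSn p z.re * jacobiSn q z.im)
      / (jacobiDn p z.re * jacobiDn q z.im)) ^ 2 < 1 := by
    rw [div_pow, div_lt_one (by positivity)]
    linarith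
  obtain ⟨h1, h2⟩ := hasDerivAt_artanh hlt
  constructor
  · refine ContDiffAt.comp z h2 ?_
    exact (contDiffAt_const.mul ((contDiff_re (contDiff_jacobiSn hp)).contDiffAt.mul
      (contDiff_im (contDiff_jacobiSn hq)).contDiffAt)).div
      ((contDiff_re (contDiff_jacobiDn hp)).contDiffAt.mul
      (contDiff_im (contDiff_jacobiDn hq)).contDiffAt) (mul_pos hd hD).ne'
  · have hT : HasPartials (fun w => p * q * (jacobiSn p w.re * jacobiSn q w.im)
        / (jacobiDn p w.re * jacobiDn q w.im))
        (p * q * (jacobiCn p z.re / jacobiDn p z.re ^ 2 * (jacobiSn q z.im / jacobiDn q z.im)))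
        (p * q * (jacobiSn p z.re / jacobiDn p z.re * (jacobiCn q z.im / jacobiDn q z.im ^ 2)))
        z := by
      convert! (hasDerivAt_jacobiSn_div_jacobiDn hp z.re).hasPartials_const_mul_mul
        (hasDerivAt_jacobiSn_div_jacobiDn hq z.im) (p * q) using 2
      field_simp
    have hden : 1 - (p * q * (jacobiSn p z.re * jacobiSn q z.im)
        / (jacobiDn p z.re * jacobiDn q z.im)) ^ 2
        = jacobiNorm p q z / (jacobiDn p z.re * jacobiDn q z.im) ^ 2 := by
      rw [← e]
      field_simp
    rw [hden] at h1
    refine (h1.comp_hasPartials hT).congr ?_ ?_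
    · field_simp
    · field_simp

theorem dualComp₂_regular (h : HyperboloidModules a b c p q) {z : ℂ} (hz : z ∈ dualDomain p q) :
    ContDiffAt ℝ (⊤ : ℕ∞) (dualComp₂ p q) z ∧
    HasPartials (dualComp₂ p q)
      (q * jacobiSn q z.im * (p ^ 2 * jacobiSn p z.re * jacobiCn p z.re) / jacobiNorm p q z)
      (q * jacobiDn p z.re * (jacobiCn q z.im * jacobiDn q z.im) / jacobiNorm p q z) z := by
  have hp := h.p_sq_lt
  have hq := h.q_sq_lt
  have hJ := h.jacobiValues z.re z.im
  have hN := hJ.norm_pos hz.2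
  have hd := hJ.d_pos
  have e : jacobiDn p z.re ^ 2 - (q * jacobiSn q z.im) ^ 2 = jacobiNorm p q z := by
    rw [jacobiNorm, hJ.norm_eq₄]
    ring
  have hN' : 0 < jacobiNorm p q z := hN
  have hlt : (q * jacobiSn q z.im / jacobiDn p z.re) ^ 2 < 1 := by
    rw [div_pow, div_lt_one (by positivity)]
    linarith
  obtain ⟨h1, h2⟩ := hasDerivAt_artanh hlt
  constructor
  · refine ContDiffAt.comp z h2 ?_
    exact (contDiffAt_const.mul (contDiff_im (contDiff_jacobiSn hq)).contDiffAt).div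
      (contDiff_re (contDiff_jacobiDn hp)).contDiffAt hd.ne'
  · have hT : HasPartials (fun w => q * jacobiSn q w.im / jacobiDn p w.re)
        (q * (p ^ 2 * jacobiSn p z.re * jacobiCn p z.re / jacobiDn p z.re ^ 2 * jacobiSn q z.im))
        (q * (1 / jacobiDn p z.re * (jacobiCn q z.im * jacobiDn q z.im))) z := by
      convert! (hasDerivAt_one_div_jacobiDn hp z.re).hasPartials_const_mul_mul
        (hasDerivAt_jacobiSn hq z.im) q using 2
      field_simp
    have hden : 1 - (q * jacobiSn q z.im / jacobiDn p z.re) ^ 2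
        = jacobiNorm p q z / jacobiDn p z.re ^ 2 := by
      rw [← e]
      field_simp
    rw [hden] at h1
    refine (h1.comp_hasPartials hT).congr ?_ ?_
    · field_simp
    · field_simp

/-! ### Branches of the dual -/

variable {U : Set ℂ} {X : ℂ → E3}

theorem IsJacobiPole.jacobiSn_eq_zero (h : HyperboloidModules a b c p q) {z : ℂ}
    (hz : z ∈ dualDomain p q) (hp : IsJacobiPole p z) : jacobiSn p z.re = 0 := by
  rw [IsJacobiPole, h.jacobiDenom_eq] at hp
  have hp0 := h.p_pos
  have hS := hz.1
  by_contra h0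
  have : 0 < jacobiCn q z.im ^ 2 + p ^ 2 * jacobiSn p z.re ^ 2 * jacobiSn q z.im ^ 2 := by
    positivity
  exact this.ne' hp

/-- The function `dn_p u cn_q v`. Up to a quarter turn, the angle that occurs in the first component
of the dual is the argument of `angleCos + i angleSin`. -/
noncomputable def angleCos (p q : ℝ) (z : ℂ) : ℝ := jacobiDn p z.re * jacobiCn q z.im

/-- The function `p cn_p u sn_q v`. -/
noncomputable def angleSin (p q : ℝ) (z : ℂ) : ℝ := p * (jacobiCn p z.re * jacobiSn q z.im)

theorem contDiff_angleCos (h : HyperboloidModules a b c p q) :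
    ContDiff ℝ (⊤ : ℕ∞) (angleCos p q) :=
  (contDiff_re (contDiff_jacobiDn h.p_sq_lt)).mul (contDiff_im (contDiff_jacobiCn h.q_sq_lt))

theorem contDiff_angleSin (h : HyperboloidModules a b c p q) :
    ContDiff ℝ (⊤ : ℕ∞) (angleSin p q) :=
  contDiff_const.mul
    ((contDiff_re (contDiff_jacobiCn h.p_sq_lt)).mul (contDiff_im (contDiff_jacobiSn h.q_sq_lt)))

theorem angleCos_sq_add_angleSin_sq (h : HyperboloidModules a b c p q) (z : ℂ) :
    angleCos p q z ^ 2 + angleSin p q z ^ 2 = jacobiNorm p q z := by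
  rw [jacobiNorm, (h.jacobiValues z.re z.im).norm_eq₁, angleCos, angleSin]
  ring

theorem jacobiNorm_pos (h : HyperboloidModules a b c p q) {z : ℂ} (hz : z ∈ dualDomain p q) :
    0 < jacobiNorm p q z := (h.jacobiValues z.re z.im).norm_pos hz.2

theorem isDualBranch_of_eqs (h : HyperboloidModules a b c p q) (hUd : U ⊆ dualDomain p q)
    {t : ℂ → ℝ} (ht : ContinuousOn t U)
    (h0 : ∀ z ∈ U, angleCos p q z * Real.cos (t z) + angleSin p q z * Real.sin (t z) = 0) :
    IsDualBranch a b c p q U fun z =>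
      !₂[2 * a / p * t z, 2 * b / (p * q) * dualComp₁ p q z, 2 * c / q * dualComp₂ p q z] := by
  refine ⟨?_, fun z hz hp => ?_⟩
  · have h1 : ContinuousOn (dualComp₁ p q) U := fun z hz =>
      (dualComp₁_regular h (hUd hz)).1.continuousAt.continuousWithinAt
    have h2 : ContinuousOn (dualComp₂ p q) U := fun z hz =>
      (dualComp₂_regular h (hUd hz)).1.continuousAt.continuousWithinAt
    refine (PiLp.continuous_toLp 2 _).comp_continuousOn (continuousOn_pi.2 fun i => ?_)
    fin_cases i
    · exact continuousOn_const.mul ht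
    · exact continuousOn_const.mul h1
    · exact continuousOn_const.mul h2
  · have hz' := hUd hz
    have h0' := h0 z hz
    rw [angleCos, angleSin, ← mul_assoc p] at h0'
    obtain ⟨θ₁, hθ₁, e₁⟩ := (exists_arctan_re_iff h hz' hp _).2 h0'
    obtain ⟨θ₂, hθ₂, e₂⟩ := (exists_artanh_re_iff₁ h hz' hp _).2 rfl
    obtain ⟨θ₃, hθ₃, e₃⟩ := (exists_artanh_re_iff₂ h hz' hp _).2 rfl
    exact ⟨θ₁, θ₂, θ₃, hθ₁, hθ₂, hθ₃, by rw [e₁, e₂, e₃]; rfl⟩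

theorem exists_isDualBranch (h : HyperboloidModules a b c p q) (hU : IsOpen U)
    (hUd : U ⊆ dualDomain p q) (hs : IsSimplyConnected U) :
    ∃ X : ℂ → E3, IsDualBranch a b c p q U X := by
  have hA := (contDiff_angleCos h).continuous
  have hB := (contDiff_angleSin h).continuous
  obtain ⟨f, hf, hfg⟩ := Complex.exists_continuousOn_eqOn_exp_comp hs hU
    (g := fun z => angleCos p q z + angleSin p q z * Complex.I)
    (by fun_prop) (by
      rintro ⟨z, hz, hz0⟩
      have hre := congrArg Complex.re hz0
      have him := congrArg Complex.im hz0
      simp at hre him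
      have hN := jacobiNorm_pos h (hUd hz)
      rw [← angleCos_sq_add_angleSin_sq h, hre, him] at hN
      simp at hN)
  -- The imaginary part of the logarithm is arg(A + iB); the quarter turn makes exp(it) orthogonal
  -- to A + iB.
  refine ⟨_, isDualBranch_of_eqs h hUd (t := fun z => (f z).im + Real.pi / 2) ?_ fun z hz => ?_⟩
  · exact (Complex.continuous_im.comp_continuousOn hf).add continuousOn_const
  · have he := hfg hz
    have hre := congrArg Complex.re he
    have him := congrArg Complex.im he
    simp [Complex.exp_re, Complex.exp_im] at hre him
    rw [Real.cos_add_pi_div_two, Real.sin_add_pi_div_two, ← hre, ← him]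
    ring

/-- The definition constrains X only off the poles; continuity of X and density of the set sn_p u ≠
0 remove this restriction. -/
theorem IsDualBranch.eqs (h : HyperboloidModules a b c p q) (hU : IsOpen U)
    (hUd : U ⊆ dualDomain p q) (hX : IsDualBranch a b c p q U X) :
    (∀ z ∈ U, angleCos p q z * Real.cos (p / (2 * a) * X z 0)
      + angleSin p q z * Real.sin (p / (2 * a) * X z 0) = 0) ∧
    (∀ z ∈ U, X z 1 = 2 * b / (p * q) * dualComp₁ p q z) ∧
    (∀ z ∈ U, X z 2 = 2 * c / q * dualComp₂ p q z) := by
  have ha := h.a_pos.ne'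
  have hp0 := h.p_pos.ne'
  have hXc : ∀ i, ContinuousOn (fun z => X z i) U := fun i =>
    ((continuous_apply i).comp (PiLp.continuous_ofLp 2 _)).comp_continuousOn hX.1
  have hA := (contDiff_angleCos h).continuous
  have hB := (contDiff_angleSin h).continuous
  have h1 : ContinuousOn (dualComp₁ p q) U := fun z hz =>
    (dualComp₁_regular h (hUd hz)).1.continuousAt.continuousWithinAt
  have h2 : ContinuousOn (dualComp₂ p q) U := fun z hz =>
    (dualComp₂_regular h (hUd hz)).1.continuousAt.continuousWithinAt
  have hdense : U ⊆ closure (U ∩ {z : ℂ | jacobiSn p z.re ≠ 0}) :=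
    (dense_jacobiSn_ne_zero h.p_sq_lt).open_subset_closure_inter hU
  have hpt : ∀ z ∈ U ∩ {z : ℂ | jacobiSn p z.re ≠ 0},
      angleCos p q z * Real.cos (p / (2 * a) * X z 0)
        + angleSin p q z * Real.sin (p / (2 * a) * X z 0) = 0 ∧
      X z 1 = 2 * b / (p * q) * dualComp₁ p q z ∧ X z 2 = 2 * c / q * dualComp₂ p q z := by
    rintro z ⟨hz, hs⟩
    have hz' := hUd hz
    have hp : ¬ IsJacobiPole p z := fun hp => hs (hp.jacobiSn_eq_zero h hz')
    obtain ⟨θ₁, θ₂, θ₃, hθ₁, hθ₂, hθ₃, e⟩ := hX.2 z hz hp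
    have e₁ := (exists_arctan_re_iff h hz' hp _).1 ⟨θ₁, hθ₁, rfl⟩
    have e₂ := (exists_artanh_re_iff₁ h hz' hp _).1 ⟨θ₂, hθ₂, rfl⟩
    have e₃ := (exists_artanh_re_iff₂ h hz' hp _).1 ⟨θ₃, hθ₃, rfl⟩
    refine ⟨?_, ?_, ?_⟩
    · have : p / (2 * a) * X z 0 = θ₁.re := by
        rw [e]
        simp
        field_simp
      rw [this, angleCos, angleSin, ← mul_assoc p]
      exact e₁
    · rw [e, dualComp₁, ← e₂]
      simp
    · rw [e, dualComp₂, ← e₃]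
      simp
  refine ⟨?_, ?_, ?_⟩
  · have hX0 := hXc 0
    exact Set.EqOn.of_subset_closure (g := fun _ => (0 : ℝ)) (fun z hz => (hpt z hz).1)
      (by fun_prop) continuousOn_const Set.inter_subset_left hdense
  · exact Set.EqOn.of_subset_closure (fun z hz => (hpt z hz).2.1) (hXc 1)
      (continuousOn_const.mul h1) Set.inter_subset_left hdense
  · exact Set.EqOn.of_subset_closure (fun z hz => (hpt z hz).2.2) (hXc 2)
      (continuousOn_const.mul h2) Set.inter_subset_left hdense

theorem IsDualBranch.regular (h : HyperboloidModules a b c p q) (hU : IsOpen U)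
    (hUd : U ⊆ dualDomain p q) (hX : IsDualBranch a b c p q U X) :
    ContDiffOn ℝ (⊤ : ℕ∞) X U ∧ ∀ z ∈ U,
      partialU X z = (2 * jacobiSn q z.im / jacobiNorm p q z) • tangentU a b c p q z ∧
      partialV X z = (2 * jacobiDn p z.re / jacobiNorm p q z) • tangentV a b c p q z := by
  obtain ⟨h0, h1, h2⟩ := hX.eqs h hU hUd
  have ha := h.a_pos.ne'
  have hp0 := h.p_pos.ne'
  have hq0 := h.q_pos.ne'
  have key : ∀ z ∈ U, (∀ i, ContDiffAt ℝ (⊤ : ℕ∞) (fun w => X w i) z) ∧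
      ∀ i, HasPartials (fun w => X w i)
        (((2 * jacobiSn q z.im / jacobiNorm p q z) • tangentU a b c p q z) i)
        (((2 * jacobiDn p z.re / jacobiNorm p q z) • tangentV a b c p q z) i) z := by
    intro z hz
    have hN := jacobiNorm_pos h (hUd hz)
    have hAB := angleCos_sq_add_angleSin_sq h z
    have hnhds := hU.mem_nhds hz
    have hJ := h.jacobiValues z.re z.im
    have e0 : ∀ᶠ w in nhds z, angleCos p q w * Real.cos (p / (2 * a) * X w 0)
      + angleSin p q w * Real.sin (p / (2 * a) * X w 0) = 0 := Filter.eventually_of_mem hnhds h0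
    have e1 : (fun w => X w 1) =ᶠ[nhds z] fun w => 2 * b / (p * q) * dualComp₁ p q w :=
      Filter.eventually_of_mem hnhds h1
    have e2 : (fun w => X w 2) =ᶠ[nhds z] fun w => 2 * c / q * dualComp₂ p q w :=
      Filter.eventually_of_mem hnhds h2
    have hX0 : ContinuousAt (fun w => X w 0) z :=
      ((continuous_apply 0).comp (PiLp.continuous_ofLp 2 _)).continuousAt.comp
        (hX.1.continuousAt hnhds)
    have hc0 : ContDiffAt ℝ (⊤ : ℕ∞) (fun w => p / (2 * a) * X w 0) z :=
      contDiffAt_angle (contDiff_angleCos h).contDiffAt (contDiff_angleSin h).contDiffAt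
        (continuousAt_const.mul hX0) e0 (by rw [hAB]; exact hN)
    -- Rescaling passes between the coordinate of X and the angle, to which the angle lemmas apply.
    have eX : (fun w => X w 0) = fun w => 2 * a / p * (p / (2 * a) * X w 0) := by
      funext w
      field_simp
    obtain ⟨hc1, hp1⟩ := dualComp₁_regular h (hUd hz)
    obtain ⟨hc2, hp2⟩ := dualComp₂_regular h (hUd hz)
    have hpc : HasPartials (angleCos p q)
        (1 * (-p ^ 2 * jacobiSn p z.re * jacobiCn p z.re * jacobiCn q z.im))
        (1 * (jacobiDn p z.re * (-jacobiSn q z.im * jacobiDn q z.im))) z := by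
      simpa only [angleCos, one_mul] using!
        (hasDerivAt_jacobiDn h.p_sq_lt z.re).hasPartials_const_mul_mul
          (hasDerivAt_jacobiCn h.q_sq_lt z.im) 1
    have hps : HasPartials (angleSin p q) _ _ z :=
      (hasDerivAt_jacobiCn h.p_sq_lt z.re).hasPartials_const_mul_mul
        (hasDerivAt_jacobiSn h.q_sq_lt z.im) p
    have hp0' := (hpc.angle hps (hc0.differentiableAt (by simp)) e0
      (by rw [hAB]; exact hN)).const_mul (2 * a / p)
    rw [hAB, ← eX] at hp0'
    constructor
    · intro i
      fin_cases i
      · change ContDiffAt ℝ (⊤ : ℕ∞) (fun w => X w 0) z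
        rw [eX]
        exact contDiffAt_const.mul hc0
      · exact (contDiffAt_const.mul hc1).congr_of_eventuallyEq e1
      · exact (contDiffAt_const.mul hc2).congr_of_eventuallyEq e2
    · intro i
      fin_cases i
      · refine hp0'.congr ?_ ?_
        · simp only [angleCos, angleSin, tangentU]
          simp
          field_simp
          linear_combination (-jacobiSn p z.re * jacobiCn q z.im * jacobiSn q z.im) *
            (hJ.d_sq - p ^ 2 * hJ.c_sq - hJ.pq)
        · simp only [angleCos, angleSin, tangentV]
          simp
          field_simp
          linear_combination (jacobiDn p z.re * jacobiCn p z.re * jacobiDn q z.im) * hJ.C_sq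
      · refine HasFDerivAt.congr_of_eventuallyEq (HasPartials.congr (hp1.const_mul _) ?_ ?_) e1
        · simp [tangentU]
          field_simp
        · simp [tangentV]
          field_simp
      · refine HasFDerivAt.congr_of_eventuallyEq (HasPartials.congr (hp2.const_mul _) ?_ ?_) e2
        · simp [tangentU]
          field_simp
        · simp [tangentV]
          field_simp
  refine ⟨contDiffOn_euclidean.2 fun i z hz => ((key z hz).1 i).contDiffWithinAt,
    fun z hz => ⟨partialU_of_hasPartials (key z hz).2, partialV_of_hasPartials (key z hz).2⟩⟩

theorem IsCurvatureLineParam.mono {V : Set ℂ} {f : ℂ → E3} (hf : IsCurvatureLineParam V f)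
    (hUV : U ⊆ V) : IsCurvatureLineParam U f :=
  ⟨⟨hf.1.1.mono hUV, fun z hz => hf.1.2 z (hUV hz)⟩, fun z hz => hf.2 z (hUV hz)⟩

theorem IsDualBranch.isChristoffelPair (h : HyperboloidModules a b c p q) (hU : IsOpen U)
    (hUd : U ⊆ dualDomain p q) (hX : IsDualBranch a b c p q U X) :
    IsCurvatureLineParam U X ∧ IsChristoffelPair U (hyperboloidParam a b c p q) X := by
  obtain ⟨hs, hpart⟩ := hX.regular h hU hUd
  have hd : ∀ z : ℂ, 0 < jacobiDn p z.re := fun z => jacobiDn_pos h.p_sq_lt z.re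
  refine ((isCurvatureLineParam_hyperboloidParam h).mono hUd).isChristoffelPair_of_partials hU hs
    -- The ratio of 2S/N to 1/(S d²), and also of 2d/N to 1/(d S²); the minus sign in x_v gives the
    -- reversed orientation.
    (ρ := fun z => 2 * jacobiSn q z.im ^ 2 * jacobiDn p z.re ^ 2 / jacobiNorm p q z)
    (fun z hz => ?_) (fun z hz => ?_) (fun z hz => ?_) fun z hz => ?_
  · have hS := (hUd hz).1
    have := hd z
    have := jacobiNorm_pos h (hUd hz)
    positivity
  · have hsn := contDiff_jacobiSn h.p_sq_lt
    have hdn := contDiff_jacobiDn h.p_sq_lt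
    have hSn := contDiff_jacobiSn h.q_sq_lt
    have hDn := contDiff_jacobiDn h.q_sq_lt
    have hnum : ContDiff ℝ (⊤ : ℕ∞) fun z : ℂ => 2 * jacobiSn q z.im ^ 2 * jacobiDn p z.re ^ 2 :=
      (contDiff_const.mul ((contDiff_im hSn).pow 2)).mul ((contDiff_re hdn).pow 2)
    have hden : ContDiff ℝ (⊤ : ℕ∞) (jacobiNorm p q) :=
      ((contDiff_im hDn).pow 2).sub (contDiff_const.mul ((contDiff_re hsn).pow 2))
    exact (hnum.contDiffAt.div hden.contDiffAt
      (jacobiNorm_pos h (hUd hz)).ne').differentiableAt (by simp)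
  · have hS := (hUd hz).1
    have := (hd z).ne'
    rw [(hpart z hz).1, (partials_hyperboloidParam h (hUd hz)).1, smul_smul]
    congr 1
    field_simp
  · have hS := (hUd hz).1
    have := (hd z).ne'
    rw [(hpart z hz).2, (partials_hyperboloidParam h (hUd hz)).2, smul_smul]
    congr 1
    field_simp

theorem mainTheorem6 (a b c p q : ℝ) (hb : 0 < b) (hc : 0 < c) (hab : b < a)
    (hp : p = Real.sqrt ((a ^ 2 - b ^ 2) / (a ^ 2 + c ^ 2)))
    (hq : q = Real.sqrt ((b ^ 2 + c ^ 2) / (a ^ 2 + c ^ 2))) :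
    ∃ x : ℂ → E3,
      IsCurvatureLineParam (dualDomain p q) x ∧
      x '' dualDomain p q = hyperboloid a b c \ hyperboloidUmbilics a b c ∧
      (∀ U : Set ℂ, IsOpen U → U ⊆ dualDomain p q → SimplyConnectedSpace U →
        ∃ X : ℂ → E3, IsDualBranch a b c p q U X) ∧
      (∀ U : Set ℂ, IsOpen U → U ⊆ dualDomain p q →
        ∀ X : ℂ → E3, IsDualBranch a b c p q U X →
          IsCurvatureLineParam U X ∧ IsChristoffelPair U x X) := by
  have h := hyperboloidModules hb hc hab hp hq
  exact ⟨hyperboloidParam a b c p q, isCurvatureLineParam_hyperboloidParam h,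
    image_hyperboloidParam h, fun U hU hUd hs => exists_isDualBranch h hU hUd hs,
    fun U hU hUd X hX => hX.isChristoffelPair h hU hUd⟩
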